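/- All curves are smooth, projective and defined over $\mathbb{C}$. Let $C$ be a curve of genus 2 with hyperelliptic projection $\pi_C:C\to\mathbb{P}^1$, let $E_1$ be an elliptic curve with projection $\pi_{E}:E_1\to E_1/\{\pm1\}=\mathbb{P}^1$, and let $\psi:C\to E_1$ be a covering of degree 5, the origin of $E_1$ being chosen such that there is a map $\phi:\mathbb{P}^1\to\mathbb{P}^1$ (the corresponding Frey--Kani covering) with $\phi\circ\pi_C=\pi_E\circ\psi$. Suppose that $\phi$ is of ramification type II, iii): it is branched over exactly four points; over two of them there are exactly two ramified points, both of index 2; over a third one there is exactly one ramified point, of index 4; over the fourth one there is exactly one ramified point, of index 2. Then there are $u,v,d,w,t\in\mathbb{C}$ such that $C$ can be given by the equation $$Y^2=x(x-1)(x-d)(x^3-ux^2+vx-w)$$ (whose right-hand side has six distinct roots), $E_1$ is isomorphic to the elliptic curve $y^2=z(z-1)(z-t)$, $$15u^4-82u^3-8vu^2+159u^2-140u+56vu-16v^2-52v+50=0,$$ and one of the following holds: (a) $2u-3\neq0$, $6u^2-10u+5-8v\neq0$, and $$d=\frac{(3u^2-4u-4v+1)^2}{(2u-3)(6u^2-10u+5-8v)},\qquad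 w=-\frac{(u^2-6u+4v+5)(u^2-4v)}{8(2u-3)},$$ $$t=\frac{(u^2-4v)(-8u^4+24u^3+63u^2+64v^2-192uv+196v+16u^2v-180u+100)}{(2u-3)(6u^2-10u+5-8v)};$$ (b) (the exceptional case, in which the fractions in (a) have the form $0/0$) $$u=\tfrac32,\quad v=\tfrac7{16},\quad d=\frac{5+3\sqrt5}{10},\quad w=\frac{\sqrt5-1}{32},\quad t=\frac{2+\sqrt5}{4}.$$ -/

import Mathlib

open Polynomial

/-! Smooth projective curves over `ℂ` are represented by their function fields, and
nonconstant morphisms `C → E` by `ℂ`-embeddings of function fields in the opposite direction. -/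

/-- `K` is the function field of the genus 2 curve `Y² = f(X)`, where `f` is a squarefree
polynomial of degree 5 or 6 (a binary sextic with distinct roots on the projective line), and
`x, y ∈ K` are the coordinate functions `X, Y` of that model. The function `x : C → ℙ¹` is then the
degree 2 projection `π_C`, the quotient by the hyperelliptic involution `(x, y) ↦ (x, -y)`. -/
structure IsGenusTwoCurve {K : Type*} [Field K] [Algebra ℂ K] (f : ℂ[X]) (x y : K) : Prop where
  squarefree : Squarefree f
  natDegree : f.natDegree = 5 ∨ f.natDegree = 6
  transcendental : Transcendental ℂ x
  equation : y ^ 2 = aeval x f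
  generates : IntermediateField.adjoin ℂ {x, y} = ⊤

/-- The `x`-coordinate of an elliptic curve as an element of its function field, that is, the
degree 2 projection `π_E : E → ℙ¹`, the quotient by `P ↦ -P`. -/
noncomputable def xCoord (E : WeierstrassCurve ℂ) : E.toAffine.FunctionField :=
  algebraMap E.toAffine.CoordinateRing E.toAffine.FunctionField
    (WeierstrassCurve.Affine.CoordinateRing.mk E.toAffine (C X))

/-- The degree of the covering `C → E` given by an embedding `ψ` of function fields. -/
noncomputable def coverDegree {K : Type*} [Field K] [Algebra ℂ K] {E : WeierstrassCurve ℂ}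
    (ψ : E.toAffine.FunctionField →ₐ[ℂ] K) : ℕ :=
  Module.finrank ψ.fieldRange K

/-- `φ : ℙ¹ → ℙ¹` is the Frey-Kani covering corresponding to `ψ : C → E`, where `x = π_C`:
the diagram `φ ∘ π_C = π_E ∘ ψ` commutes. -/
def IsFreyKaniCover {K : Type*} [Field K] [Algebra ℂ K] {E : WeierstrassCurve ℂ}
    (x : K) (ψ : E.toAffine.FunctionField →ₐ[ℂ] K) (φ : RatFunc ℂ) : Prop :=
  ψ (xCoord E) = aeval x φ.num / aeval x φ.denom

/-- The degree of a rational function as a map `ℙ¹ → ℙ¹`. -/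
noncomputable def mapDegree (φ : RatFunc ℂ) : ℕ :=
  max φ.num.natDegree φ.denom.natDegree

/-- For nonconstant `φ = p / q` in lowest terms, the polynomial whose roots are the finite points
of the fibre of `φ` over a point of `ℙ¹(ℂ)`: `p - c q` over `c`, and `q` over `∞`. -/
noncomputable def fiberPoly (φ : RatFunc ℂ) : OnePoint ℂ → ℂ[X]
  | none => φ.denom
  | some c => φ.num - C c * φ.denom

/-- The multiplicity of `P` in the fibre of `φ` over `Q`: this is the ramification index of `φ` at
`P` if `φ(P) = Q`, and `0` otherwise. -/
noncomputable def ramIndex (φ : RatFunc ℂ) (Q : OnePoint ℂ) : OnePoint ℂ → ℕ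
  | none => mapDegree φ - (fiberPoly φ Q).natDegree
  | some a => (fiberPoly φ Q).rootMultiplicity a

/-- The multiset of the ramification indices `≥ 2` of the points in the fibre over `Q`. -/
noncomputable def ramificationData (φ : RatFunc ℂ) (Q : OnePoint ℂ) : Multiset ℕ :=
  (ramIndex φ Q none ::ₘ
    (fiberPoly φ Q).roots.toFinset.val.map fun a => ramIndex φ Q (some a)).filter (2 ≤ ·)

/-- `φ` has ramification data `σ 0, …, σ (r - 1)` over `r` distinct points of `ℙ¹` and is
unramified over all other points. -/
def HasRamificationType (φ : RatFunc ℂ) {r : ℕ} (σ : Fin r → Multiset ℕ) : Prop :=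
  ∃ q : Fin r → OnePoint ℂ, Function.Injective q ∧
    (∀ i, ramificationData φ (q i) = σ i) ∧
    ∀ Q, Q ∉ Set.range q → ramificationData φ Q = 0

/-- The ramification type II, iii), for odd `n ≥ 5`:
`((2)^((n-1)/2), (2)^((n-1)/2), (4)^1 (2)^((n-5)/2), (2)^((n-3)/2))`. -/
def typeTwoThree (n : ℕ) : Fin 4 → Multiset ℕ :=
  ![Multiset.replicate ((n - 1) / 2) 2,
    Multiset.replicate ((n - 1) / 2) 2,
    4 ::ₘ Multiset.replicate ((n - 5) / 2) 2,
    Multiset.replicate ((n - 3) / 2) 2]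

/-- The polynomial `X (X - 1) (X - d) (X³ - u X² + v X - w)`. -/
noncomputable def normalSextic (u v d w : ℂ) : ℂ[X] :=
  X * (X - 1) * (X - C d) * (X ^ 3 - C u * X ^ 2 + C v * X - C w)

/-- The Weierstrass curve `y² = z (z - 1) (z - t) = z³ - (1 + t) z² + t z`. -/
def legendreCurve (t : ℂ) : WeierstrassCurve ℂ where
  a₁ := 0
  a₂ := -(1 + t)
  a₃ := 0
  a₄ := t
  a₆ := 0

/-!
Write `z` for the coordinate on `E / {±1}`. The function `η = 2 y + a₁ z + a₃` on `E` satisfies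
`η² = g(z)` with `g` the two-torsion polynomial, so `ψ(η)² = g(φ(x))`. As `[K : ψ(ℂ(E))] = 5` is odd
and `[K : ℂ(x)] = 2`, `ψ(η)` is not in `ℂ(x)`; hence it is a multiple of `y` by a rational function
of `x`, and comparing degrees over `ℂ(φ(x))` shows that `φ` has degree five (`mapDegree_eq_five`).
Consequently the product of the fibre polynomials of `φ` over the four branch points of `π_E` equals
`f` up to squares, so these fibres contain at most six finite points of odd multiplicity. A fibre of
degree five has an odd number of points of odd multiplicity, and five of them if it is unramified.
Therefore the branch points of `π_E` are exactly those of `φ` (`branchPoints_eq`), and the six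
Weierstrass points of `C` are the simple points of the four ramified fibres.

Choose the coordinate on the source with the point of index `4` at infinity and the simple points of
the two fibres of type `2, 2` at `0` and `1` (`exists_normalFibres`). The four fibre polynomials
become multiples of `X A²`, `(X - 1) B²`, `X - d` and `(X - g)² Q` with `A`, `B` monic quadratic and
`Q = X³ - u X² + v X - w`. They lie in one pencil, so
`X A² - (X - 1) B² = δ (X - d)` and `X A² - (X - g)² Q = k (X - d)`,
where `k / δ` is the cross ratio of the branch points, a Legendre parameter of `E`
(`exists_variableChange_crossRatio`). Comparing coefficients in the first identity, and using that
the Wronskian of `X A²` and `X - d` vanishes at `g`, one finds all the parameters as Laurent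
polynomials in a single `s` (`parametrization_of_fibre_identities`), and the asserted formulas are
identities in `s` (`formulas_of_parametrization`). The fractions degenerate exactly for `s² = 5`.
The two values of `s` are exchanged by interchanging `0` and `1`, which gives the exceptional case
with the stated choice of `√5`.
-/

/-! ### The one-parameter family of solutions -/

/-- The coefficients of a polynomial function of degree at most four that vanishes identically. -/
theorem coeffs_eq_zero_of_forall_quartic {c₀ c₁ c₂ c₃ c₄ : ℂ}
    (h : ∀ z : ℂ, c₄ * z ^ 4 + c₃ * z ^ 3 + c₂ * z ^ 2 + c₁ * z + c₀ = 0) :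
    c₄ = 0 ∧ c₃ = 0 ∧ c₂ = 0 ∧ c₁ = 0 ∧ c₀ = 0 := by
  have h0 := h 0
  have h1 := h 1
  have h2 := h 2
  have h3 := h (-1)
  have h4 := h (-2)
  refine ⟨?_, ?_, ?_, ?_, ?_⟩
  · linear_combination (h2 + h4 - 4 * h1 - 4 * h3 + 6 * h0) / 24
  · linear_combination (h2 - h4 - 2 * h1 + 2 * h3) / 12
  · linear_combination (-h2 - h4 + 16 * h1 + 16 * h3 - 30 * h0) / 24
  · linear_combination (-h2 + h4 + 8 * h1 - 8 * h3) / 12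
  · linear_combination h0

/-- The two identities between the fibre polynomials determine all parameters as Laurent
polynomials in `s = 4 a + 5`: the first one leaves a single free parameter, and the second one then
determines the double point `g` and with it the cubic factor. -/
theorem parametrization_of_fibre_identities {a b a' b' u v w d g δ k : ℂ}
    (h₁ : ∀ z : ℂ, z * (z ^ 2 + a * z + b) ^ 2 - (z - 1) * (z ^ 2 + a' * z + b') ^ 2
      = δ * (z - d))
    (h₂ : ∀ z : ℂ, z * (z ^ 2 + a * z + b) ^ 2
      - (z - g) ^ 2 * (z ^ 3 - u * z ^ 2 + v * z - w) = k * (z - d))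
    (hδ : δ ≠ 0) (hA : g ^ 2 + a * g + b ≠ 0) (hB : g ^ 2 + a' * g + b' ≠ 0) :
    ∃ s : ℂ, s ≠ 0 ∧ d = -(s - 1) ^ 2 / (4 * s) ∧ u = (-s ^ 2 + 12 * s + 5) / (8 * s) ∧
      v = (-5 * s ^ 4 - 32 * s ^ 3 + 122 * s ^ 2 + 160 * s + 75) / (256 * s ^ 2) ∧
      w = (-3 * s ^ 6 - 10 * s ^ 5 - 29 * s ^ 4 - 12 * s ^ 3 + 35 * s ^ 2 + 150 * s + 125)
        / (1024 * s ^ 3) ∧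
      k / δ = (-27 * s ^ 8 - 36 * s ^ 6 + 512 * s ^ 5 - 50 * s ^ 4 - 2500 * s ^ 2 + 3125)
        / (1024 * s ^ 5) := by
  obtain ⟨s, rfl⟩ : ∃ s, a = (s - 5) / 4 := ⟨4 * a + 5, by ring⟩
  obtain ⟨e4, e3, e2, e1, e0⟩ := coeffs_eq_zero_of_forall_quartic
    (c₄ := 2 * ((s - 5) / 4) - (2 * a' - 1))
    (c₃ := ((s - 5) / 4) ^ 2 + 2 * b - (a' ^ 2 + 2 * b' - 2 * a'))
    (c₂ := 2 * ((s - 5) / 4) * b - (2 * a' * b' - a' ^ 2 - 2 * b'))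
    (c₁ := b ^ 2 - (b' ^ 2 - 2 * a' * b') - δ) (c₀ := b' ^ 2 + δ * d)
    (fun z => by linear_combination h₁ z)
  obtain ⟨f4, f3, f2, f1, f0⟩ := coeffs_eq_zero_of_forall_quartic
    (c₄ := 2 * ((s - 5) / 4) + u + 2 * g)
    (c₃ := ((s - 5) / 4) ^ 2 + 2 * b - (v + 2 * g * u + g ^ 2))
    (c₂ := 2 * ((s - 5) / 4) * b + (w + 2 * g * v + g ^ 2 * u))
    (c₁ := b ^ 2 - (2 * g * w + g ^ 2 * v) - k) (c₀ := g ^ 2 * w + k * d)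
    (fun z => by linear_combination h₂ z)
  obtain rfl : a' = (s - 3) / 4 := by linear_combination -e4 / 2
  obtain rfl : b' = b + (s - 2) / 8 := by linear_combination -e3 / 2
  obtain rfl : b = -(3 * s - 5) / 16 := by linear_combination e2
  obtain rfl : δ = s / 64 := by linear_combination -e1
  have hs : s ≠ 0 := by rintro rfl; simp at hδ
  obtain rfl : d = -(s - 1) ^ 2 / (4 * s) := by
    field_simp
    linear_combination 256 * e0
  -- Both `z A²` and `(z - g)² Q` have the same Wronskian with `z - d`, and it vanishes at `g`.
  have hW : (g ^ 2 + (s - 5) / 4 * g + -(3 * s - 5) / 16) *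
      ((g ^ 2 + (s - 5) / 4 * g + -(3 * s - 5) / 16 + 2 * g * (2 * g + (s - 5) / 4))
        * (g - -(s - 1) ^ 2 / (4 * s))
        - g * (g ^ 2 + (s - 5) / 4 * g + -(3 * s - 5) / 16)) = 0 := by
    linear_combination (g - -(s - 1) ^ 2 / (4 * s)) *
      (4 * f4 * g ^ 3 + 3 * f3 * g ^ 2 + 2 * f2 * g + f1) - h₂ g
  have hg : (g ^ 2 + (s - 3) / 4 * g + (-(3 * s - 5) / 16 + (s - 2) / 8)) *
      (g - -(s - 1) * (3 * s - 5) / (16 * s)) = 0 := by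
    have := (mul_eq_zero.mp hW).resolve_left hA
    field_simp at this ⊢
    linear_combination 8 * this
  obtain rfl := sub_eq_zero.mp ((mul_eq_zero.mp hg).resolve_left hB)
  obtain rfl : u = (-s ^ 2 + 12 * s + 5) / (8 * s) := by
    field_simp at f4 ⊢
    linear_combination f4 / 8
  obtain rfl : v = (-5 * s ^ 4 - 32 * s ^ 3 + 122 * s ^ 2 + 160 * s + 75) / (256 * s ^ 2) := by
    field_simp at f3 ⊢
    linear_combination -f3 / 128
  obtain rfl : w = (-3 * s ^ 6 - 10 * s ^ 5 - 29 * s ^ 4 - 12 * s ^ 3 + 35 * s ^ 2 + 150 * s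
      + 125) / (1024 * s ^ 3) := by
    field_simp at f2 ⊢
    linear_combination f2 / 2048
  refine ⟨s, hs, rfl, rfl, rfl, rfl, ?_⟩
  obtain rfl : k = (-27 * s ^ 8 - 36 * s ^ 6 + 512 * s ^ 5 - 50 * s ^ 4 - 2500 * s ^ 2 + 3125)
      / (65536 * s ^ 4) := by
    field_simp at f1 ⊢
    linear_combination -f1 / 1024
  field_simp
  ring

/-- The family parametrized by `s` satisfies the asserted equation between `u` and `v` and the asserted
formulas for `d`, `w` and `t`, unless `s² = 5`, which is the case `2 u = 3`. -/
theorem formulas_of_parametrization {u v w d t s : ℂ} (hs : s ≠ 0)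
    (hd : d = -(s - 1) ^ 2 / (4 * s)) (hu : u = (-s ^ 2 + 12 * s + 5) / (8 * s))
    (hv : v = (-5 * s ^ 4 - 32 * s ^ 3 + 122 * s ^ 2 + 160 * s + 75) / (256 * s ^ 2))
    (hw : w = (-3 * s ^ 6 - 10 * s ^ 5 - 29 * s ^ 4 - 12 * s ^ 3 + 35 * s ^ 2 + 150 * s + 125)
        / (1024 * s ^ 3))
    (ht : t = (-27 * s ^ 8 - 36 * s ^ 6 + 512 * s ^ 5 - 50 * s ^ 4 - 2500 * s ^ 2 + 3125)
        / (1024 * s ^ 5)) :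
    15 * u ^ 4 - 82 * u ^ 3 - 8 * v * u ^ 2 + 159 * u ^ 2 - 140 * u + 56 * v * u
        - 16 * v ^ 2 - 52 * v + 50 = 0 ∧
      ((2 * u - 3 ≠ 0 ∧ 6 * u ^ 2 - 10 * u + 5 - 8 * v ≠ 0 ∧
        d = (3 * u ^ 2 - 4 * u - 4 * v + 1) ^ 2
          / ((2 * u - 3) * (6 * u ^ 2 - 10 * u + 5 - 8 * v)) ∧
        w = -((u ^ 2 - 6 * u + 4 * v + 5) * (u ^ 2 - 4 * v) / (8 * (2 * u - 3))) ∧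
        t = (u ^ 2 - 4 * v)
            * (-8 * u ^ 4 + 24 * u ^ 3 + 63 * u ^ 2 + 64 * v ^ 2 - 192 * u * v + 196 * v
              + 16 * u ^ 2 * v - 180 * u + 100)
          / ((2 * u - 3) * (6 * u ^ 2 - 10 * u + 5 - 8 * v))) ∨
       s ^ 2 = 5) := by
  have hu' : 2 * u - 3 = (5 - s ^ 2) / (4 * s) := by rw [hu]; field_simp; ring
  have hM : 6 * u ^ 2 - 10 * u + 5 - 8 * v = (s ^ 2 - 5) / 4 := by rw [hu, hv]; field_simp; ring
  constructor
  · rw [hu, hv]; field_simp; ring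
  · by_cases h5 : s ^ 2 = 5
    · exact Or.inr h5
    · have h1 : 5 - s ^ 2 ≠ 0 := fun h => h5 (by linear_combination -h)
      have h2 : s ^ 2 - 5 ≠ 0 := fun h => h5 (by linear_combination h)
      refine Or.inl ⟨?_, ?_, ?_, ?_, ?_⟩
      · rw [hu']; exact div_ne_zero h1 (by simpa using hs)
      · rw [hM]; exact div_ne_zero h2 (by norm_num)
      · rw [hu', hM, hd, hu, hv, eq_div_iff (by simp [h1, h2, hs])]; field_simp; ring
      · rw [hu', hw, hu, hv, ← neg_div, eq_div_iff (by simp [h1, hs])]; field_simp; ring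
      · rw [hu', hM, ht, hu, hv, eq_div_iff (by simp [h1, h2, hs])]; field_simp; ring

/-! ### Weierstrass curves in Legendre form -/

/-- The polynomial `4 z³ + b₂ z² + 2 b₄ z + b₆`, whose roots are the
`z`-coordinates of the points of order two. -/
noncomputable def twoTorsionPoly (E : WeierstrassCurve ℂ) : ℂ[X] :=
  C 4 * X ^ 3 + C E.b₂ * X ^ 2 + C (2 * E.b₄) * X + C E.b₆

theorem eq_twoTorsion_coeffs_of_roots {E : WeierstrassCurve ℂ} {e₁ e₂ e₃ : ℂ}
    (h₁₂ : e₁ ≠ e₂) (h₁₃ : e₁ ≠ e₃) (h₂₃ : e₂ ≠ e₃)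
    (h₁ : (twoTorsionPoly E).IsRoot e₁) (h₂ : (twoTorsionPoly E).IsRoot e₂)
    (h₃ : (twoTorsionPoly E).IsRoot e₃) :
    E.b₂ = -4 * (e₁ + e₂ + e₃) ∧ E.b₄ = 2 * (e₁ * e₂ + e₁ * e₃ + e₂ * e₃) ∧
      E.b₆ = -4 * (e₁ * e₂ * e₃) := by
  simp only [twoTorsionPoly, IsRoot, eval_add, eval_mul, eval_C, eval_pow, eval_X] at h₁ h₂ h₃
  have d₁₂ : 4 * (e₁ ^ 2 + e₁ * e₂ + e₂ ^ 2) + E.b₂ * (e₁ + e₂) + 2 * E.b₄ = 0 :=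
    mul_left_cancel₀ (sub_ne_zero.mpr h₁₂) (by linear_combination h₁ - h₂)
  have d₁₃ : 4 * (e₁ ^ 2 + e₁ * e₃ + e₃ ^ 2) + E.b₂ * (e₁ + e₃) + 2 * E.b₄ = 0 :=
    mul_left_cancel₀ (sub_ne_zero.mpr h₁₃) (by linear_combination h₁ - h₃)
  have hb₂ : E.b₂ = -4 * (e₁ + e₂ + e₃) :=
    mul_left_cancel₀ (sub_ne_zero.mpr h₂₃) (by linear_combination d₁₂ - d₁₃)
  have hb₄ : E.b₄ = 2 * (e₁ * e₂ + e₁ * e₃ + e₂ * e₃) := by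
    rw [hb₂] at d₁₂
    linear_combination d₁₂ / 2
  refine ⟨hb₂, hb₄, ?_⟩
  rw [hb₂, hb₄] at h₁
  linear_combination h₁

/-- Over `ℂ` an elliptic curve has three distinct nontrivial points of order two. -/
theorem exists_distinct_roots_twoTorsionPoly (E : WeierstrassCurve ℂ) [E.IsElliptic] :
    ∃ e₁ e₂ e₃ : ℂ, e₁ ≠ e₂ ∧ e₁ ≠ e₃ ∧ e₂ ≠ e₃ ∧
      twoTorsionPoly E = C 4 * ((X - C e₁) * (X - C e₂) * (X - C e₃)) := by
  obtain ⟨e₁, h₁⟩ := Complex.exists_root (f := C 4 * X ^ 3 + C E.b₂ * X ^ 2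
    + C (2 * E.b₄) * X + C E.b₆) (by rw [degree_cubic (by norm_num)]; norm_num)
  obtain ⟨e₂, h₂⟩ := Complex.exists_root (f := C 4 * X ^ 2 + C (E.b₂ + 4 * e₁) * X
    + C (2 * E.b₄ + E.b₂ * e₁ + 4 * e₁ ^ 2)) (by rw [degree_quadratic (by norm_num)]; norm_num)
  simp only [IsRoot, eval_add, eval_mul, eval_C, eval_pow, eval_X] at h₁ h₂
  obtain ⟨e₃, h₃⟩ : ∃ e₃, E.b₂ = -4 * (e₁ + e₂ + e₃) := ⟨-E.b₂ / 4 - e₁ - e₂, by ring⟩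
  have hb₄ : E.b₄ = 2 * (e₁ * e₂ + e₁ * e₃ + e₂ * e₃) := by
    rw [h₃] at h₂; linear_combination h₂ / 2
  have hb₆ : E.b₆ = -4 * (e₁ * e₂ * e₃) := by
    rw [h₃, hb₄] at h₁; linear_combination h₁
  have hΔ : E.Δ = 16 * ((e₁ - e₂) * (e₁ - e₃) * (e₂ - e₃)) ^ 2 := by
    have hb₈ : 4 * E.b₈ = E.b₂ * E.b₆ - E.b₄ ^ 2 := E.b_relation
    rw [WeierstrassCurve.Δ]
    rw [h₃, hb₄, hb₆] at *
    linear_combination -4 * (e₁ + e₂ + e₃) ^ 2 * hb₈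
  have hΔ0 : E.Δ ≠ 0 := E.isUnit_Δ.ne_zero
  rw [hΔ] at hΔ0
  refine ⟨e₁, e₂, e₃, ?_, ?_, ?_, ?_⟩
  · rintro rfl; simp at hΔ0
  · rintro rfl; simp at hΔ0
  · rintro rfl; simp at hΔ0
  · rw [twoTorsionPoly, h₃, hb₄, hb₆]
    simp only [map_mul, map_add, map_neg, map_ofNat]
    ring

/-- An elliptic curve whose points of order two have `z`-coordinates `α, β, γ` is isomorphic to
the Legendre curve whose parameter is the affine ratio of these three numbers. -/
theorem exists_variableChange_legendreCurve (E : WeierstrassCurve ℂ) {α β γ : ℂ}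
    (hαβ : α ≠ β) (hαγ : α ≠ γ) (hβγ : β ≠ γ) (hα : (twoTorsionPoly E).IsRoot α)
    (hβ : (twoTorsionPoly E).IsRoot β) (hγ : (twoTorsionPoly E).IsRoot γ) :
    ∃ c : WeierstrassCurve.VariableChange ℂ,
      c • E = legendreCurve ((α - γ) / (β - γ)) := by
  obtain ⟨h₂, h₄, h₆⟩ := eq_twoTorsion_coeffs_of_roots hαβ hαγ hβγ hα hβ hγ
  obtain ⟨u, hu⟩ := IsAlgClosed.exists_pow_nat_eq (β - γ) two_pos
  have hβγ' : β - γ ≠ 0 := sub_ne_zero.mpr hβγ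
  have hu0 : u ≠ 0 := by rintro rfl; exact hβγ' (by simpa using hu.symm)
  rw [WeierstrassCurve.b₂] at h₂
  rw [WeierstrassCurve.b₄] at h₄
  rw [WeierstrassCurve.b₆] at h₆
  have hβ' : β = u ^ 2 + γ := by linear_combination -hu
  subst hβ'
  refine ⟨⟨Units.mk0 u hu0, γ, -E.a₁ / 2, -(E.a₃ + γ * E.a₁) / 2⟩, ?_⟩
  have hi : ((Units.mk0 u hu0)⁻¹ : ℂˣ) = (u⁻¹ : ℂ) := rfl
  ext
  · simp only [WeierstrassCurve.variableChange_a₁, hi, legendreCurve]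
    ring
  · simp only [WeierstrassCurve.variableChange_a₂, hi, legendreCurve]
    field_simp
    linear_combination u ^ 2 * h₂
  · simp only [WeierstrassCurve.variableChange_a₃, hi, legendreCurve]
    ring
  · simp only [WeierstrassCurve.variableChange_a₄, hi, legendreCurve]
    field_simp
    linear_combination u ^ 2 * h₄ + γ * u ^ 2 * h₂
  · simp only [WeierstrassCurve.variableChange_a₆, hi, legendreCurve]
    field_simp
    linear_combination h₆ + 2 * γ * h₄ + γ ^ 2 * h₂

/-- The substitution `z ↦ 1 - z` exchanges the Legendre parameters `t` and `1 - t`. -/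
theorem exists_variableChange_legendreCurve_one_sub (t : ℂ) :
    ∃ c : WeierstrassCurve.VariableChange ℂ, c • legendreCurve t = legendreCurve (1 - t) := by
  refine ⟨⟨Units.mk0 Complex.I Complex.I_ne_zero, 1, 0, 0⟩, ?_⟩
  have hi : ((Units.mk0 Complex.I Complex.I_ne_zero)⁻¹ : ℂˣ) = (-Complex.I : ℂ) := by
    rw [← Complex.inv_I]; rfl
  ext
  · simp only [WeierstrassCurve.variableChange_a₁, hi, legendreCurve]
    ring
  · simp only [WeierstrassCurve.variableChange_a₂, hi, legendreCurve]
    linear_combination (2 - t) * Complex.I_sq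
  · simp only [WeierstrassCurve.variableChange_a₃, hi, legendreCurve]
    ring
  · simp only [WeierstrassCurve.variableChange_a₄, hi, legendreCurve]
    linear_combination (1 - t) * (Complex.I ^ 2 - 1) * Complex.I_sq
  · simp only [WeierstrassCurve.variableChange_a₆, hi, legendreCurve]
    ring

/-! ### The function field of a Weierstrass curve -/

theorem aeval_mem_intermediateField {K : Type*} [Field K] [Algebra ℂ K]
    {S : IntermediateField ℂ K} {z : K} (hz : z ∈ S) (p : ℂ[X]) : aeval z p ∈ S := by
  have := S.aeval_coe ⟨z, hz⟩ p
  rw [this]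
  exact SetLike.coe_mem _

/-- The function `2 y + a₁ x + a₃` on a Weierstrass curve, whose square is a polynomial in `x`. -/
noncomputable def completedYCoord (E : WeierstrassCurve ℂ) : E.toAffine.FunctionField :=
  algebraMap E.toAffine.CoordinateRing E.toAffine.FunctionField
    (WeierstrassCurve.Affine.CoordinateRing.mk E.toAffine
      (C (C 2) * X + C (C E.a₁ * X + C E.a₃)))

theorem aeval_xCoord (E : WeierstrassCurve ℂ) (p : ℂ[X]) :
    aeval (xCoord E) p = algebraMap E.toAffine.CoordinateRing E.toAffine.FunctionField
      (WeierstrassCurve.Affine.CoordinateRing.mk E.toAffine (C p)) := by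
  have : xCoord E = algebraMap ℂ[X] E.toAffine.FunctionField X := rfl
  rw [this, aeval_algebraMap_apply, aeval_X_left_apply]
  rfl

theorem completedYCoord_sq (E : WeierstrassCurve ℂ) :
    completedYCoord E ^ 2 = aeval (xCoord E) (twoTorsionPoly E) := by
  rw [aeval_xCoord, completedYCoord, ← map_pow, ← map_pow]
  congr 1
  rw [← sub_eq_zero, ← map_sub]
  refine AdjoinRoot.mk_eq_zero.mpr ⟨4, ?_⟩
  rw [WeierstrassCurve.Affine.polynomial, twoTorsionPoly, WeierstrassCurve.b₂,
    WeierstrassCurve.b₄, WeierstrassCurve.b₆]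
  simp only [map_add, map_mul, map_pow, map_ofNat]
  ring

theorem adjoin_xCoord_completedYCoord (E : WeierstrassCurve ℂ) :
    IntermediateField.adjoin ℂ {xCoord E, completedYCoord E} = ⊤ := by
  set S := IntermediateField.adjoin ℂ {xCoord E, completedYCoord E} with hS
  let ι : ℂ[X][X] →+* E.toAffine.FunctionField :=
    (algebraMap E.toAffine.CoordinateRing E.toAffine.FunctionField).comp
      (WeierstrassCurve.Affine.CoordinateRing.mk E.toAffine)
  have hx : xCoord E ∈ S := IntermediateField.subset_adjoin _ _ (by simp)
  have hη : completedYCoord E ∈ S := IntermediateField.subset_adjoin _ _ (by simp)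
  have hC (p : ℂ[X]) : ι (C p) ∈ S := by
    have : ι (C p) = aeval (xCoord E) p := (aeval_xCoord E p).symm
    rw [this]
    exact aeval_mem_intermediateField hx p
  have hY : ι X ∈ S := by
    have h2 : ι X = (completedYCoord E - ι (C (C E.a₁ * X + C E.a₃))) / ι (C (C 2)) := by
      have h20 : ι (C (C 2)) ≠ 0 := by
        rw [show ι (C (C 2)) = algebraMap ℂ E.toAffine.FunctionField 2 from rfl]
        exact (_root_.map_ne_zero _).mpr two_ne_zero
      rw [eq_div_iff h20]
      have : completedYCoord E = ι (C (C 2) * X + C (C E.a₁ * X + C E.a₃)) := rfl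
      rw [this, map_add, map_mul]
      ring
    rw [h2]
    exact S.div_mem (S.sub_mem hη (hC _)) (hC _)
  have hι (p : ℂ[X][X]) : ι p ∈ S := by
    induction p using Polynomial.induction_on' with
    | add p q hp hq => rw [map_add]; exact S.add_mem hp hq
    | monomial n p =>
      rw [← C_mul_X_pow_eq_monomial, map_mul, map_pow]
      exact S.mul_mem (hC p) (S.pow_mem hY n)
  rw [eq_top_iff]
  intro z _
  obtain ⟨p, q, -, rfl⟩ := IsFractionRing.div_surjective (A := E.toAffine.CoordinateRing) z
  obtain ⟨p, rfl⟩ := AdjoinRoot.mk_surjective p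
  obtain ⟨q, rfl⟩ := AdjoinRoot.mk_surjective q
  exact S.div_mem (hι p) (hι q)


/-! ### Quadratic extensions -/

theorem relfinrank_eq_two_of_sq_mem {K : Type*} [Field K] [Algebra ℂ K]
    {A B : IntermediateField ℂ K} {η : K} (hAB : A ≤ B) (hη : η ∈ B)
    (hB : B ≤ A ⊔ IntermediateField.adjoin ℂ {η}) (hsq : η ^ 2 ∈ A) (hA : η ∉ A) :
    A.relfinrank B = 2 := by
  rw [IntermediateField.relfinrank_eq_finrank_of_le hAB]
  have h : IntermediateField.extendScalars hAB = IntermediateField.adjoin A {η} := by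
    apply le_antisymm
    · rw [IntermediateField.extendScalars_le_iff]
      refine hB.trans (sup_le ?_ ?_)
      · intro a ha
        exact (IntermediateField.adjoin A {η}).algebraMap_mem ⟨a, ha⟩
      · rw [IntermediateField.adjoin_le_iff, Set.singleton_subset_iff]
        exact IntermediateField.mem_adjoin_simple_self A η
    · rw [IntermediateField.adjoin_le_iff, Set.singleton_subset_iff]
      exact hη
  have hroot : aeval η (X ^ 2 - C (⟨η ^ 2, hsq⟩ : A)) = 0 := by
    simp
  have hint : IsIntegral A η := ⟨_, monic_X_pow_sub_C _ two_ne_zero, hroot⟩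
  rw [h, IntermediateField.adjoin.finrank hint]
  apply le_antisymm
  · refine (natDegree_le_of_dvd (minpoly.dvd A η hroot)
      (monic_X_pow_sub_C _ two_ne_zero).ne_zero).trans ?_
    rw [natDegree_X_pow_sub_C]
  · rw [minpoly.two_le_natDegree_iff hint]
    rintro ⟨a, rfl⟩
    exact hA a.2

/-! ### Coverings of odd degree of an elliptic curve -/

theorem aeval_ne_zero_of_transcendental {K : Type*} [Field K] [Algebra ℂ K] {x : K}
    (hx : Transcendental ℂ x) {p : ℂ[X]} (hp : p ≠ 0) : aeval x p ≠ 0 :=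
  fun h => hp (transcendental_iff.mp hx p h)

theorem aeval_injective_of_transcendental {K : Type*} [Field K] [Algebra ℂ K] {x : K}
    (hx : Transcendental ℂ x) {p q : ℂ[X]} (h : aeval x p = aeval x q) : p = q :=
  sub_eq_zero.mp (transcendental_iff.mp hx _ (by rw [map_sub, h, sub_self]))

/-- The degree of `ℂ(x)` over `ℂ(φ(x))` is the degree of `φ`. -/
theorem relfinrank_adjoin_aeval {K : Type*} [Field K] [Algebra ℂ K] {x : K}
    (hx : Transcendental ℂ x) (φ : RatFunc ℂ) :
    (IntermediateField.adjoin ℂ {aeval x φ.num / aeval x φ.denom}).relfinrank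
      (IntermediateField.adjoin ℂ {x}) = mapDegree φ := by
  let e := RatFunc.algEquivOfTranscendental x hx
  let ι : RatFunc ℂ →ₐ[ℂ] K := (IntermediateField.adjoin ℂ {x}).val.comp e.toAlgHom
  have hφ : ι φ = aeval x φ.num / aeval x φ.denom :=
    RatFunc.algEquivOfTranscendental_apply x hx φ
  have hX : ι RatFunc.X = x := RatFunc.algEquivOfTranscendental_X x hx
  have h₁ := IntermediateField.adjoin_map ℂ {φ} ι
  have h₂ := IntermediateField.adjoin_map ℂ {RatFunc.X} ι
  rw [Set.image_singleton, hφ] at h₁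
  rw [Set.image_singleton, hX, RatFunc.adjoin_X] at h₂
  rw [← h₁, ← h₂, IntermediateField.relfinrank_map_map, IntermediateField.relfinrank_top_right,
    RatFunc.finrank_eq_max_natDegree]
  rfl

/-- A squarefree polynomial of positive degree is not the square of a rational function. -/
theorem not_mem_adjoin_of_sq_eq_aeval {K : Type*} [Field K] [Algebra ℂ K] {x y : K}
    (hx : Transcendental ℂ x) {f : ℂ[X]} (hf : Squarefree f) (hdeg : f.natDegree ≠ 0)
    (hy : y ^ 2 = aeval x f) : y ∉ IntermediateField.adjoin ℂ {x} := by
  intro h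
  obtain ⟨r, s, rfl⟩ := (IntermediateField.mem_adjoin_simple_iff ℂ y).mp h
  have hf0 : f ≠ 0 := by rintro rfl; simp at hdeg
  have hs : aeval x s ≠ 0 := by
    intro h0
    rw [h0, div_zero] at hy
    exact aeval_ne_zero_of_transcendental hx hf0 (by rw [← hy]; simp)
  rw [div_pow, div_eq_iff (pow_ne_zero 2 hs), ← map_pow, ← map_pow, ← map_mul] at hy
  have hrs := aeval_injective_of_transcendental hx hy
  have hs0 : s ≠ 0 := by rintro rfl; simp at hs
  obtain ⟨t, rfl⟩ : s ∣ r := (IsIntegrallyClosed.pow_dvd_pow_iff two_ne_zero).mp ⟨f, by rw [hrs, mul_comm]⟩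
  rw [mul_pow, mul_comm f] at hrs
  have := mul_left_cancel₀ (pow_ne_zero 2 hs0) hrs
  have ht : IsUnit t := hf t ⟨1, by rw [← this]; ring⟩
  exact hdeg (natDegree_eq_zero_of_isUnit (this ▸ ht.pow 2))

section Covering

variable {K : Type*} [Field K] [Algebra ℂ K] {f : ℂ[X]} {x y : K} {E : WeierstrassCurve ℂ}
  {ψ : E.toAffine.FunctionField →ₐ[ℂ] K} {φ : RatFunc ℂ}

theorem IsGenusTwoCurve.natDegree_ne_zero (hC : IsGenusTwoCurve f x y) : f.natDegree ≠ 0 := by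
  rcases hC.natDegree with h | h <;> omega

theorem IsGenusTwoCurve.finrank_adjoin (hC : IsGenusTwoCurve f x y) :
    Module.finrank (IntermediateField.adjoin ℂ {x}) K = 2 := by
  rw [← IntermediateField.relfinrank_top_right]
  refine relfinrank_eq_two_of_sq_mem (η := y) le_top trivial ?_ ?_ ?_
  · rw [← hC.generates, ← IntermediateField.adjoin_union]
    rfl
  · rw [hC.equation]
    exact aeval_mem_intermediateField (IntermediateField.mem_adjoin_simple_self ℂ x) f
  · exact not_mem_adjoin_of_sq_eq_aeval hC.transcendental hC.squarefree hC.natDegree_ne_zero hC.equation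

theorem fieldRange_eq_adjoin :
    ψ.fieldRange = IntermediateField.adjoin ℂ {ψ (xCoord E)} ⊔
      IntermediateField.adjoin ℂ {ψ (completedYCoord E)} := by
  rw [← IntermediateField.adjoin_union, AlgHom.fieldRange_eq_map,
    ← adjoin_xCoord_completedYCoord E, IntermediateField.adjoin_map, Set.image_pair]
  rfl

theorem completedYCoord_sq_mem :
    ψ (completedYCoord E) ^ 2 ∈ IntermediateField.adjoin ℂ {ψ (xCoord E)} := by
  rw [← map_pow, completedYCoord_sq, ← aeval_algHom_apply]
  exact aeval_mem_intermediateField (IntermediateField.mem_adjoin_simple_self ℂ _) _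

/-- A covering of odd degree does not factor through the projection `π_C`: its degree would be
even. -/
theorem completedYCoord_not_mem (hC : IsGenusTwoCurve f x y) (hψ : coverDegree ψ = 5)
    (hφ : IsFreyKaniCover x ψ φ) :
    ψ (completedYCoord E) ∉ IntermediateField.adjoin ℂ {x} := by
  intro h
  have hle : ψ.fieldRange ≤ IntermediateField.adjoin ℂ {x} := by
    rw [fieldRange_eq_adjoin]
    refine sup_le ?_ ?_ <;> rw [IntermediateField.adjoin_le_iff, Set.singleton_subset_iff]
    · rw [hφ]
      exact (IntermediateField.mem_adjoin_simple_iff ℂ _).mpr ⟨_, _, rfl⟩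
    · exact h
  have := IntermediateField.relfinrank_mul_finrank_top hle
  rw [hC.finrank_adjoin] at this
  rw [coverDegree] at hψ
  omega

/-- Both towers `ℂ(φ(x)) ⊆ ℂ(x) ⊆ K` and `ℂ(φ(x)) ⊆ ψ(ℂ(E)) ⊆ K` have degree `10`. -/
theorem mapDegree_eq_five (hC : IsGenusTwoCurve f x y) (hψ : coverDegree ψ = 5)
    (hφ : IsFreyKaniCover x ψ φ) : mapDegree φ = 5 := by
  have hle : IntermediateField.adjoin ℂ {ψ (xCoord E)} ≤ IntermediateField.adjoin ℂ {x} := by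
    rw [IntermediateField.adjoin_le_iff, Set.singleton_subset_iff, hφ]
    exact (IntermediateField.mem_adjoin_simple_iff ℂ _).mpr ⟨_, _, rfl⟩
  have hle' : IntermediateField.adjoin ℂ {ψ (xCoord E)} ≤ ψ.fieldRange := by
    rw [fieldRange_eq_adjoin]
    exact le_sup_left
  have h₁ := IntermediateField.relfinrank_mul_finrank_top hle
  have h₂ := IntermediateField.relfinrank_mul_finrank_top hle'
  have h₃ : (IntermediateField.adjoin ℂ {ψ (xCoord E)}).relfinrank ψ.fieldRange = 2 := by
    refine relfinrank_eq_two_of_sq_mem (η := ψ (completedYCoord E)) hle' ⟨_, rfl⟩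
      fieldRange_eq_adjoin.le completedYCoord_sq_mem fun h => ?_
    exact completedYCoord_not_mem hC hψ hφ (hle h)
  have h₄ := relfinrank_adjoin_aeval hC.transcendental φ
  rw [← hφ] at h₄
  rw [h₄, hC.finrank_adjoin] at h₁
  rw [coverDegree] at hψ
  rw [h₃, hψ] at h₂
  omega

/-- `ψ` maps the function `2 y + a₁ x + a₃` of `E` to an anti-invariant function of the
hyperelliptic involution. -/
theorem exists_completedYCoord_eq (hC : IsGenusTwoCurve f x y) (hψ : coverDegree ψ = 5)
    (hφ : IsFreyKaniCover x ψ φ) :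
    ∃ r s : ℂ[X], r ≠ 0 ∧ s ≠ 0 ∧
      ψ (completedYCoord E) * aeval x s = aeval x r * y := by
  set L := IntermediateField.adjoin ℂ {x} with hL
  set η := ψ (completedYCoord E) with hη
  have hyL : y ∉ L :=
    not_mem_adjoin_of_sq_eq_aeval hC.transcendental hC.squarefree hC.natDegree_ne_zero hC.equation
  have hηL : η ∉ L := completedYCoord_not_mem hC hψ hφ
  have hle : IntermediateField.adjoin ℂ {ψ (xCoord E)} ≤ L := by
    rw [IntermediateField.adjoin_le_iff, Set.singleton_subset_iff, hφ]
    exact (IntermediateField.mem_adjoin_simple_iff ℂ _).mpr ⟨_, _, rfl⟩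
  have hηsq : η ^ 2 ∈ L := hle completedYCoord_sq_mem
  have hysq : y ^ 2 ∈ L := by
    rw [hC.equation]
    exact aeval_mem_intermediateField (IntermediateField.mem_adjoin_simple_self ℂ x) f
  have hli : LinearIndependent L ![(1 : K), y] := by
    rw [LinearIndependent.pair_iff]
    intro a b hab
    have hb : b = 0 := by
      by_contra hb
      apply hyL
      have hb' : (b : K) ≠ 0 := by simpa using hb
      have : y = -(a : K) / b := by
        rw [eq_div_iff hb']
        have h : (a : K) * 1 + b * y = 0 := hab
        linear_combination h
      rw [this]
      exact L.div_mem (L.neg_mem a.2) b.2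
    subst hb
    refine ⟨?_, rfl⟩
    have h : (a : K) * 1 + ((0 : L) : K) * y = 0 := hab
    simpa using h
  have hfin : FiniteDimensional L K := FiniteDimensional.of_finrank_eq_succ hC.finrank_adjoin
  have hspan := hli.span_eq_top_of_card_eq_finrank' (by
    rw [Fintype.card_fin]; exact hC.finrank_adjoin.symm)
  have hmem : η ∈ Submodule.span L (Set.range ![(1 : K), y]) := by rw [hspan]; trivial
  rw [Matrix.range_cons, Matrix.range_cons, Matrix.range_empty, Set.union_empty,
    Set.singleton_union, Submodule.mem_span_pair] at hmem
  obtain ⟨a, b, hab⟩ := hmem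
  have hab' : (a : K) * 1 + b * y = η := hab
  have hb : (b : K) ≠ 0 := by
    intro hb
    apply hηL
    rw [← hab', hb, zero_mul, add_zero, mul_one]
    exact a.2
  have ha : (a : K) = 0 := by
    by_contra ha
    apply hyL
    have : y = (η ^ 2 - a ^ 2 - b ^ 2 * y ^ 2) / (2 * a * b) := by
      rw [eq_div_iff (by
        have : (2 : K) ≠ 0 := by
          rw [← map_ofNat (algebraMap ℂ K) 2]
          exact (_root_.map_ne_zero _).mpr two_ne_zero
        exact mul_ne_zero (mul_ne_zero this ha) hb), ← hab']
      ring
    rw [this]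
    have h2 : (2 : K) ∈ L := ofNat_mem L 2
    exact L.div_mem (L.sub_mem (L.sub_mem hηsq (pow_mem a.2 2))
      (L.mul_mem (pow_mem b.2 2) hysq)) (L.mul_mem (L.mul_mem h2 a.2) b.2)
  obtain ⟨r, s, hrs⟩ := (IntermediateField.mem_adjoin_simple_iff ℂ (b : K)).mp b.2
  rw [hrs] at hb hab'
  rw [div_ne_zero_iff] at hb
  refine ⟨r, s, ?_, ?_, ?_⟩
  · rintro rfl; simp at hb
  · rintro rfl; simp at hb
  · rw [← hab', ha]
    field_simp [hb.2]
    ring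

/-- The homogenization `q³ g(p / q)` of the two-torsion polynomial `g`. -/
noncomputable def homogenizedTwoTorsion (E : WeierstrassCurve ℂ) (p q : ℂ[X]) : ℂ[X] :=
  C 4 * p ^ 3 + C E.b₂ * p ^ 2 * q + C (2 * E.b₄) * p * q ^ 2 + C E.b₆ * q ^ 3

theorem completedYCoord_sq_mul (hC : IsGenusTwoCurve f x y) (hφ : IsFreyKaniCover x ψ φ) :
    ψ (completedYCoord E) ^ 2 * aeval x φ.denom ^ 4 =
      aeval x (homogenizedTwoTorsion E φ.num φ.denom * φ.denom) := by
  have hq := aeval_ne_zero_of_transcendental hC.transcendental φ.denom_ne_zero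
  rw [← map_pow, completedYCoord_sq, ← aeval_algHom_apply, hφ, twoTorsionPoly,
    homogenizedTwoTorsion]
  simp only [map_add, map_mul, map_pow, aeval_X, aeval_C]
  field_simp

/-- Up to squares, `f` is the product of the fibre polynomials over the four branch points of
`π_E`. -/
theorem exists_sq_mul_eq (hC : IsGenusTwoCurve f x y) (hψ : coverDegree ψ = 5)
    (hφ : IsFreyKaniCover x ψ φ) :
    ∃ r s : ℂ[X], r ≠ 0 ∧ s ≠ 0 ∧
      r ^ 2 * f = s ^ 2 * (homogenizedTwoTorsion E φ.num φ.denom * φ.denom) := by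
  obtain ⟨r, s, hr, hs, h⟩ := exists_completedYCoord_eq hC hψ hφ
  refine ⟨r * φ.denom ^ 2, s, mul_ne_zero hr (pow_ne_zero 2 φ.denom_ne_zero), hs, ?_⟩
  apply aeval_injective_of_transcendental hC.transcendental
  rw [map_mul _ (s ^ 2), ← completedYCoord_sq_mul hC hφ]
  simp only [map_mul, map_pow]
  rw [← hC.equation]
  linear_combination (-(aeval x) φ.denom ^ 4 * (ψ (completedYCoord E) * aeval x s
    + aeval x r * y)) * h

end Covering

/-! ### Fibres of a rational function -/

/-- The linear form vanishing at a point of the projective line, in the affine coordinate `X`: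
`X - a` at `a`, and the constant `1` at infinity. -/
noncomputable def pointPoly : OnePoint ℂ → ℂ[X]
  | none => 1
  | some a => X - C a

theorem pointPoly_infty : pointPoly OnePoint.infty = 1 := rfl

theorem pointPoly_coe (a : ℂ) : pointPoly (a : OnePoint ℂ) = X - C a := rfl

section Fibres

variable {φ : RatFunc ℂ}

theorem fiberPoly_none : fiberPoly φ none = φ.denom := rfl

theorem fiberPoly_some (c : ℂ) : fiberPoly φ (some c) = φ.num - C c * φ.denom := rfl

theorem fiberPoly_ne_zero (h : mapDegree φ ≠ 0) (Q : OnePoint ℂ) : fiberPoly φ Q ≠ 0 := by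
  rcases Q with _ | c
  · exact φ.denom_ne_zero
  · intro h0
    have h1 : φ.num = C c * φ.denom := sub_eq_zero.mp h0
    have h2 : IsUnit φ.denom := φ.isCoprime_num_denom.isUnit_of_dvd' ⟨C c, by rw [h1, mul_comm]⟩
      dvd_rfl
    apply h
    rw [mapDegree, h1]
    have h3 := natDegree_eq_zero_of_isUnit h2
    have h4 := natDegree_C_mul_le c φ.denom
    omega

theorem natDegree_fiberPoly_le (Q : OnePoint ℂ) : (fiberPoly φ Q).natDegree ≤ mapDegree φ := by
  rcases Q with _ | c
  · exact le_max_right _ _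
  · exact (natDegree_sub_le _ _).trans (max_le_max le_rfl (natDegree_C_mul_le c _))

/-- Distinct fibres are disjoint. -/
theorem eq_of_ramIndex_ne_zero (h : mapDegree φ ≠ 0) {Q Q' P : OnePoint ℂ}
    (hQ : ramIndex φ Q P ≠ 0) (hQ' : ramIndex φ Q' P ≠ 0) : Q = Q' := by
  rcases P with _ | a
  · have h₁ : mapDegree φ - (fiberPoly φ Q).natDegree ≠ 0 := hQ
    have h₂ : mapDegree φ - (fiberPoly φ Q').natDegree ≠ 0 := hQ'
    have key (c : ℂ) (hc : (φ.num - C c * φ.denom).natDegree < mapDegree φ) :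
        φ.denom.natDegree = mapDegree φ := by
      by_contra hne
      have hlt : φ.denom.natDegree < mapDegree φ := lt_of_le_of_ne (le_max_right _ _) hne
      have hn : φ.num.natDegree < mapDegree φ := by
        have : φ.num = (φ.num - C c * φ.denom) + C c * φ.denom := by ring
        rw [this]
        exact (natDegree_add_le _ _).trans_lt
          (max_lt hc ((natDegree_C_mul_le c _).trans_lt hlt))
      have : mapDegree φ < mapDegree φ := max_lt hn hlt
      exact lt_irrefl _ this
    rcases Q with _ | c <;> rcases Q' with _ | c'
    · rfl
    · rw [fiberPoly_none] at h₁
      have := key c' (by rw [fiberPoly_some] at h₂; omega)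
      omega
    · rw [fiberPoly_none] at h₂
      have := key c (by rw [fiberPoly_some] at h₁; omega)
      omega
    · rw [fiberPoly_some] at h₁ h₂
      have hd := key c (by omega)
      by_contra hne
      have hcc : c' - c ≠ 0 := fun h0 => hne (by rw [sub_eq_zero.mp h0])
      have : C (c' - c) * φ.denom = (φ.num - C c * φ.denom) - (φ.num - C c' * φ.denom) := by
        rw [C_sub]; ring
      have h3 := natDegree_C_mul (p := φ.denom) hcc
      rw [this, hd] at h3
      have h4 := natDegree_sub_le (φ.num - C c * φ.denom) (φ.num - C c' * φ.denom)
      omega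
  · have hr (Q : OnePoint ℂ) (hQ : ramIndex φ Q (some a) ≠ 0) : (fiberPoly φ Q).eval a = 0 :=
      ((rootMultiplicity_pos (fiberPoly_ne_zero h Q)).mp (Nat.pos_of_ne_zero hQ))
    have h₁ := hr Q hQ
    have h₂ := hr Q' hQ'
    obtain ⟨r, s, hrs⟩ := φ.isCoprime_num_denom
    have h₃ := congrArg (eval a) hrs
    simp only [eval_add, eval_mul, eval_one] at h₃
    rcases Q with _ | c <;> rcases Q' with _ | c' <;>
      simp only [fiberPoly_none, fiberPoly_some, eval_sub, eval_mul, eval_C] at h₁ h₂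
    · rfl
    · rw [h₁, mul_zero, sub_zero] at h₂
      simp [h₁, h₂] at h₃
    · rw [h₂, mul_zero, sub_zero] at h₁
      simp [h₁, h₂] at h₃
    · have h₄ : (c' - c) * eval a φ.denom = 0 := by linear_combination h₁ - h₂
      rcases mul_eq_zero.mp h₄ with h₅ | h₅
      · rw [sub_eq_zero.mp h₅]
      · rw [h₅, mul_zero, sub_zero] at h₁
        simp [h₁, h₅] at h₃

/-- A finite set of points containing the support of the fibre over `Q`: its finite points
together with infinity, whether or not infinity lies in the fibre. -/
noncomputable def fiberSupport (φ : RatFunc ℂ) (Q : OnePoint ℂ) : Finset (OnePoint ℂ) :=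
  Finset.cons OnePoint.infty
    ((fiberPoly φ Q).roots.toFinset.map ⟨OnePoint.some, OnePoint.coe_injective⟩)
    fun h => by
      obtain ⟨a, -, ha⟩ := Finset.mem_map.mp h
      exact OnePoint.coe_ne_infty a ha

theorem ramificationData_eq (Q : OnePoint ℂ) :
    ramificationData φ Q =
      ((fiberSupport φ Q).filter (2 ≤ ramIndex φ Q ·)).val.map (ramIndex φ Q) := by
  have h : ramificationData φ Q =
      ((fiberSupport φ Q).val.map (ramIndex φ Q)).filter (2 ≤ ·) := by
    rw [fiberSupport, Finset.cons_val, Multiset.map_cons, Finset.map_val, Multiset.map_map]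
    rfl
  rw [h, Finset.filter_val, Multiset.filter_map]
  rfl

theorem sum_ramIndex (Q : OnePoint ℂ) :
    ∑ P ∈ fiberSupport φ Q, ramIndex φ Q P = mapDegree φ := by
  classical
  rw [fiberSupport, Finset.sum_cons, Finset.sum_map]
  have h₁ : ∑ a ∈ (fiberPoly φ Q).roots.toFinset, (fiberPoly φ Q).rootMultiplicity a
      = (fiberPoly φ Q).natDegree := by
    rw [← splits_iff_card_roots.mp (IsAlgClosed.splits (fiberPoly φ Q)),
      ← Multiset.toFinset_sum_count_eq]
    exact Finset.sum_congr rfl fun a _ => (count_roots _).symm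
  have h₂ := natDegree_fiberPoly_le (φ := φ) Q
  change mapDegree φ - (fiberPoly φ Q).natDegree + ∑ a ∈ (fiberPoly φ Q).roots.toFinset,
    (fiberPoly φ Q).rootMultiplicity a = _
  omega

theorem fiberPoly_eq_prod (Q : OnePoint ℂ) :
    fiberPoly φ Q = C (fiberPoly φ Q).leadingCoeff *
      ∏ P ∈ fiberSupport φ Q, pointPoly P ^ ramIndex φ Q P := by
  classical
  rw [fiberSupport, Finset.prod_cons, Finset.prod_map, pointPoly_infty, one_pow, one_mul]
  conv_lhs => rw [(IsAlgClosed.splits (fiberPoly φ Q)).eq_prod_roots,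
    Finset.prod_multiset_map_count]
  congr 1
  refine Finset.prod_congr rfl fun a _ => ?_
  rw [count_roots]
  rfl

/-- The fibre over `Q` is the sum of its ramified part and its simple points. -/
theorem exists_ramified_simple_decomposition (h : mapDegree φ ≠ 0) (Q : OnePoint ℂ) :
    ∃ (T U : Finset (OnePoint ℂ)) (c : ℂ), c ≠ 0 ∧
      ramificationData φ Q = T.val.map (ramIndex φ Q) ∧ (∀ P ∈ U, ramIndex φ Q P = 1) ∧
      ∑ P ∈ T, ramIndex φ Q P + U.card = mapDegree φ ∧
      fiberPoly φ Q = C c * ((∏ P ∈ T, pointPoly P ^ ramIndex φ Q P) * ∏ P ∈ U, pointPoly P) := by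
  classical
  set S := fiberSupport φ Q with hS
  have hU : ∀ P ∈ S.filter (ramIndex φ Q · = 1), ramIndex φ Q P = 1 :=
    fun P hP => (Finset.mem_filter.mp hP).2
  have hsub : S.filter (ramIndex φ Q · = 1) ⊆ S.filter (¬ 2 ≤ ramIndex φ Q ·) := by
    intro P hP
    rw [Finset.mem_filter] at hP ⊢
    exact ⟨hP.1, by omega⟩
  have hzero : ∀ P ∈ S.filter (¬ 2 ≤ ramIndex φ Q ·), P ∉ S.filter (ramIndex φ Q · = 1) →
      ramIndex φ Q P = 0 := by
    intro P hP hP'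
    rw [Finset.mem_filter] at hP hP'
    have : ¬ ramIndex φ Q P = 1 := fun h1 => hP' ⟨hP.1, h1⟩
    omega
  refine ⟨S.filter (2 ≤ ramIndex φ Q ·), S.filter (ramIndex φ Q · = 1),
    (fiberPoly φ Q).leadingCoeff, leadingCoeff_ne_zero.mpr (fiberPoly_ne_zero h Q),
    ramificationData_eq Q, hU, ?_, ?_⟩
  · rw [← sum_ramIndex Q, ← hS, ← Finset.sum_filter_add_sum_filter_not S (2 ≤ ramIndex φ Q ·),
      ← Finset.sum_subset hsub hzero, Finset.sum_congr rfl hU, Finset.card_eq_sum_ones]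
  · conv_lhs => rw [fiberPoly_eq_prod Q, ← hS,
      ← Finset.prod_filter_mul_prod_filter_not S (2 ≤ ramIndex φ Q ·),
      ← Finset.prod_subset hsub fun P hP hP' => by rw [hzero P hP hP', pow_zero]]
    congr 2
    exact Finset.prod_congr rfl fun P hP => by rw [hU P hP, pow_one]

/-- A fibre of degree five with ramification `2, 2`. -/
theorem exists_fiberPoly_eq_of_two_two (h : mapDegree φ = 5) {Q : OnePoint ℂ}
    (hQ : ramificationData φ Q = Multiset.replicate 2 2) :
    ∃ (P P' R : OnePoint ℂ) (c : ℂ), c ≠ 0 ∧ P ≠ P' ∧ ramIndex φ Q P = 2 ∧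
      ramIndex φ Q P' = 2 ∧ ramIndex φ Q R = 1 ∧
      fiberPoly φ Q = C c * (pointPoly P ^ 2 * pointPoly P' ^ 2 * pointPoly R) := by
  classical
  obtain ⟨T, U, c, hc, hT, hU, hsum, hprod⟩ :=
    exists_ramified_simple_decomposition (h.trans_ne (by norm_num)) Q
  rw [hQ] at hT
  have hT2 : ∀ P ∈ T, ramIndex φ Q P = 2 := fun P hP =>
    Multiset.eq_of_mem_replicate (n := 2) (by rw [hT]; exact Multiset.mem_map_of_mem _ hP)
  have hTcard : T.card = 2 := by
    have := congrArg Multiset.card hT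
    simpa using this.symm
  rw [Finset.sum_congr rfl hT2, Finset.sum_const, hTcard, h] at hsum
  obtain ⟨P, P', hPP, rfl⟩ := Finset.card_eq_two.mp hTcard
  obtain ⟨R, rfl⟩ := Finset.card_eq_one.mp (show U.card = 1 by simp at hsum; omega)
  have h1 := hT2 P (by simp)
  have h2 := hT2 P' (by simp)
  refine ⟨P, P', R, c, hc, hPP, h1, h2, hU R (by simp), ?_⟩
  rw [hprod, Finset.prod_pair hPP, h1, h2, Finset.prod_singleton]

/-- A fibre of degree five with ramification `4`. -/
theorem exists_fiberPoly_eq_of_four (h : mapDegree φ = 5) {Q : OnePoint ℂ}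
    (hQ : ramificationData φ Q = {4}) :
    ∃ (P R : OnePoint ℂ) (c : ℂ), c ≠ 0 ∧ ramIndex φ Q P = 4 ∧ ramIndex φ Q R = 1 ∧
      fiberPoly φ Q = C c * (pointPoly P ^ 4 * pointPoly R) := by
  classical
  obtain ⟨T, U, c, hc, hT, hU, hsum, hprod⟩ :=
    exists_ramified_simple_decomposition (h.trans_ne (by norm_num)) Q
  rw [hQ] at hT
  have hTcard : T.card = 1 := by
    have := congrArg Multiset.card hT
    simpa using this.symm
  obtain ⟨P, rfl⟩ := Finset.card_eq_one.mp hTcard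
  have h1 : ramIndex φ Q P = 4 := by simpa using hT.symm
  rw [Finset.sum_singleton, h1, h] at hsum
  obtain ⟨R, rfl⟩ := Finset.card_eq_one.mp (show U.card = 1 by omega)
  refine ⟨P, R, c, hc, h1, hU R (by simp), ?_⟩
  rw [hprod, Finset.prod_singleton, h1, Finset.prod_singleton]

/-- A fibre of degree five with ramification `2`. -/
theorem exists_fiberPoly_eq_of_two (h : mapDegree φ = 5) {Q : OnePoint ℂ}
    (hQ : ramificationData φ Q = {2}) :
    ∃ (P R₁ R₂ R₃ : OnePoint ℂ) (c : ℂ), c ≠ 0 ∧ R₁ ≠ R₂ ∧ R₁ ≠ R₃ ∧ R₂ ≠ R₃ ∧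
      ramIndex φ Q P = 2 ∧ ramIndex φ Q R₁ = 1 ∧ ramIndex φ Q R₂ = 1 ∧ ramIndex φ Q R₃ = 1 ∧
      fiberPoly φ Q = C c * (pointPoly P ^ 2 * (pointPoly R₁ * pointPoly R₂ * pointPoly R₃)) := by
  classical
  obtain ⟨T, U, c, hc, hT, hU, hsum, hprod⟩ :=
    exists_ramified_simple_decomposition (h.trans_ne (by norm_num)) Q
  rw [hQ] at hT
  have hTcard : T.card = 1 := by
    have := congrArg Multiset.card hT
    simpa using this.symm
  obtain ⟨P, rfl⟩ := Finset.card_eq_one.mp hTcard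
  have h1 : ramIndex φ Q P = 2 := by simpa using hT.symm
  rw [Finset.sum_singleton, h1, h] at hsum
  obtain ⟨R₁, R₂, R₃, h₁₂, h₁₃, h₂₃, rfl⟩ :=
    Finset.card_eq_three.mp (show U.card = 3 by omega)
  refine ⟨P, R₁, R₂, R₃, c, hc, h₁₂, h₁₃, h₂₃, h1, hU _ (by simp), hU _ (by simp),
    hU _ (by simp), ?_⟩
  rw [hprod, Finset.prod_singleton, h1, Finset.prod_insert (by simp [h₁₂, h₁₃]),
    Finset.prod_pair h₂₃, mul_assoc (pointPoly R₁)]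

end Fibres

/-! ### Coordinates on the projective line -/

section Coordinates

variable {K : Type*} [Field K] [Algebra ℂ K]

/-- The function `z` is a coordinate on the line with coordinate `x`, with its pole at `Pinf` and
with value `m P` at any other point `P`. In terms of the linear forms `pointPoly P`, evaluated at
`x`: up to constants, the form of `Pinf` is `D` and that of `P` is `D (z - m P)`. The value of `m` at
`Pinf` has no meaning. -/
structure IsLineCoordinate (x z D : K) (Pinf : OnePoint ℂ) (m : OnePoint ℂ → ℂ) : Prop where
  adjoin_eq : IntermediateField.adjoin ℂ {z} = IntermediateField.adjoin ℂ {x}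
  ne_zero : D ≠ 0
  pole : ∃ κ : ℂ, κ ≠ 0 ∧ aeval x (pointPoly Pinf) = algebraMap ℂ K κ * D
  point : ∀ P, P ≠ Pinf → ∃ κ : ℂ, κ ≠ 0 ∧
    aeval x (pointPoly P) = algebraMap ℂ K κ * (D * (z - algebraMap ℂ K (m P)))
  injOn : ∀ P P', P ≠ Pinf → P' ≠ Pinf → m P = m P' → P = P'

theorem exists_isLineCoordinate {x : K} (hx : Transcendental ℂ x) (Pinf : OnePoint ℂ) :
    ∃ z D m, IsLineCoordinate x z D Pinf m := by
  induction Pinf using OnePoint.rec with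
  | infty =>
    refine ⟨x, 1, fun P => P.elim 0 id, rfl, one_ne_zero, ⟨1, one_ne_zero, ?_⟩, ?_, ?_⟩
    · rw [pointPoly_infty]; simp
    · intro P hP
      induction P using OnePoint.rec with
      | infty => exact absurd rfl hP
      | coe a => exact ⟨1, one_ne_zero, by rw [pointPoly_coe]; simp⟩
    · intro P P' hP hP' h
      induction P using OnePoint.rec with
      | infty => exact absurd rfl hP
      | coe a =>
        induction P' using OnePoint.rec with
        | infty => exact absurd rfl hP'
        | coe a' => rw [show a = a' from h]
  | coe b =>
    have hxb : x - algebraMap ℂ K b ≠ 0 := by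
      have := aeval_ne_zero_of_transcendental hx (X_sub_C_ne_zero b)
      simpa using this
    refine ⟨(x - algebraMap ℂ K b)⁻¹, x - algebraMap ℂ K b,
      fun P => P.elim 0 fun a => (a - b)⁻¹, ?_, hxb, ⟨1, one_ne_zero, ?_⟩, ?_, ?_⟩
    · apply le_antisymm <;> rw [IntermediateField.adjoin_le_iff, Set.singleton_subset_iff]
      · exact inv_mem (sub_mem (IntermediateField.mem_adjoin_simple_self ℂ x)
          (IntermediateField.algebraMap_mem _ b))
      · have h := add_mem (inv_mem (IntermediateField.mem_adjoin_simple_self ℂ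
          (x - algebraMap ℂ K b)⁻¹)) (IntermediateField.algebraMap_mem _ b)
        rwa [inv_inv, sub_add_cancel] at h
    · rw [pointPoly_coe]; simp
    · intro P hP
      induction P using OnePoint.rec with
      | infty =>
        refine ⟨1, one_ne_zero, ?_⟩
        rw [pointPoly_infty]
        simp [hxb]
      | coe a =>
        have hab : b - a ≠ 0 := fun h => hP (by rw [sub_eq_zero.mp h])
        refine ⟨b - a, hab, ?_⟩
        have h : algebraMap ℂ K b - algebraMap ℂ K a ≠ 0 := by
          rw [← map_sub]; exact (_root_.map_ne_zero _).mpr hab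
        have h' : algebraMap ℂ K a - algebraMap ℂ K b ≠ 0 := by
          rw [← neg_sub]; exact neg_ne_zero.mpr h
        rw [pointPoly_coe]
        simp only [OnePoint.elim_some, map_sub, map_inv₀, aeval_X, aeval_C]
        field_simp
        ring
    · intro P P' hP hP' h
      have key (a : ℂ) (ha : (a : OnePoint ℂ) ≠ b) : (a - b)⁻¹ ≠ 0 :=
        inv_ne_zero fun h => ha (by rw [sub_eq_zero.mp h])
      induction P using OnePoint.rec with
      | infty =>
        induction P' using OnePoint.rec with
        | infty => rfl
        | coe a' => exact absurd h.symm (key a' hP')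
      | coe a =>
        induction P' using OnePoint.rec with
        | infty => exact absurd h (key a hP)
        | coe a' =>
          have h : a - b = a' - b := inv_injective h
          rw [sub_left_injective h]

/-- A coordinate is determined by prescribing the points with coordinates `0`, `1` and `∞`. -/
theorem exists_isLineCoordinate_zero_one {x : K} (hx : Transcendental ℂ x)
    {Pinf P₀ P₁ : OnePoint ℂ} (h₀ : P₀ ≠ Pinf) (h₁ : P₁ ≠ Pinf) (h₀₁ : P₀ ≠ P₁) :
    ∃ z D m, IsLineCoordinate x z D Pinf m ∧ m P₀ = 0 ∧ m P₁ = 1 := by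
  obtain ⟨z, D, m, h⟩ := exists_isLineCoordinate hx Pinf
  have hm : m P₁ - m P₀ ≠ 0 := fun h' =>
    h₀₁ (h.injOn _ _ h₁ h₀ (sub_eq_zero.mp h')).symm
  have hm' : algebraMap ℂ K (m P₁ - m P₀) ≠ 0 := (_root_.map_ne_zero _).mpr hm
  set z' := (z - algebraMap ℂ K (m P₀)) / algebraMap ℂ K (m P₁ - m P₀) with hz'
  have hz : z = z' * algebraMap ℂ K (m P₁ - m P₀) + algebraMap ℂ K (m P₀) := by
    rw [hz']; field_simp; ring
  refine ⟨z', D, fun P => (m P - m P₀) / (m P₁ - m P₀), ⟨?_, h.ne_zero, h.pole, ?_, ?_⟩, ?_, ?_⟩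
  · rw [← h.adjoin_eq]
    apply le_antisymm <;> rw [IntermediateField.adjoin_le_iff, Set.singleton_subset_iff]
    · exact div_mem (sub_mem (IntermediateField.mem_adjoin_simple_self ℂ z)
        (IntermediateField.algebraMap_mem _ _)) (IntermediateField.algebraMap_mem _ _)
    · have := add_mem (mul_mem (IntermediateField.mem_adjoin_simple_self ℂ z')
        (IntermediateField.algebraMap_mem _ (m P₁ - m P₀)))
        (IntermediateField.algebraMap_mem (IntermediateField.adjoin ℂ {z'}) (m P₀))
      rwa [← hz] at this
  · intro P hP
    obtain ⟨κ, hκ, e⟩ := h.point P hP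
    refine ⟨κ * (m P₁ - m P₀), mul_ne_zero hκ hm, ?_⟩
    rw [e]
    nth_rewrite 1 [hz]
    rw [map_mul, map_div₀, map_sub _ (m P)]
    field_simp
    ring
  · intro P P' hP hP' e
    exact h.injOn P P' hP hP' (sub_left_injective ((div_left_inj' hm).mp e))
  · simp
  · exact div_self hm

theorem IsLineCoordinate.transcendental {x z D : K} {Pinf : OnePoint ℂ} {m : OnePoint ℂ → ℂ}
    (h : IsLineCoordinate x z D Pinf m) (hx : Transcendental ℂ x) : Transcendental ℂ z := by
  intro hz
  have := IntermediateField.isAlgebraic_adjoin_simple hz.isIntegral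
  rw [h.adjoin_eq] at this
  have h2 := this.isAlgebraic (⟨x, IntermediateField.mem_adjoin_simple_self ℂ x⟩ :
    IntermediateField.adjoin ℂ {x})
  exact hx ((isAlgebraic_algebraMap_iff (A := K) Subtype.val_injective).mpr h2)

end Coordinates

/-! ### The branch points -/

open scoped Classical in
/-- The finite points that occur with odd multiplicity in the fibre over `Q`. -/
noncomputable def oddPoints (φ : RatFunc ℂ) (Q : OnePoint ℂ) : Finset ℂ :=
  (fiberPoly φ Q).roots.toFinset.filter fun a => Odd ((fiberPoly φ Q).rootMultiplicity a)

section BranchPoints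

variable {φ : RatFunc ℂ}

theorem odd_of_mem_oddPoints {Q : OnePoint ℂ} {a : ℂ} (ha : a ∈ oddPoints φ Q) :
    Odd (ramIndex φ Q (a : OnePoint ℂ)) := by
  classical
  exact (Finset.mem_filter.mp ha).2

/-- If infinity does not lie in a fibre of odd degree, some finite point does so with odd
multiplicity. -/
theorem one_le_card_oddPoints (h : mapDegree φ = 5) {Q : OnePoint ℂ}
    (hQ : ramIndex φ Q OnePoint.infty = 0) : 1 ≤ (oddPoints φ Q).card := by
  classical
  rw [Nat.one_le_iff_ne_zero, Finset.card_ne_zero]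
  by_contra hne
  rw [Finset.not_nonempty_iff_eq_empty] at hne
  have hsum := sum_ramIndex (φ := φ) Q
  rw [fiberSupport, Finset.sum_cons, hQ, zero_add, Finset.sum_map, h] at hsum
  have : Even (∑ a ∈ (fiberPoly φ Q).roots.toFinset, ramIndex φ Q (a : OnePoint ℂ)) := by
    refine Finset.even_sum _ fun a ha => ?_
    by_contra hodd
    rw [Nat.not_even_iff_odd] at hodd
    have : a ∈ oddPoints φ Q := Finset.mem_filter.mpr ⟨ha, hodd⟩
    rw [hne] at this
    simp at this
  rw [show ∑ a ∈ (fiberPoly φ Q).roots.toFinset, ramIndex φ Q (a : OnePoint ℂ) = 5 from hsum]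
    at this
  exact absurd this (by decide)

/-- In an unramified fibre all points, infinity included, have multiplicity at most one. -/
theorem ramIndex_le_one_of_unramified {Q P : OnePoint ℂ} (hP : P ∈ fiberSupport φ Q)
    (hQ : ramificationData φ Q = 0) : ramIndex φ Q P ≤ 1 := by
  by_contra hlt
  have : ramIndex φ Q P ∈ ramificationData φ Q := by
    rw [ramificationData_eq]
    exact Multiset.mem_map_of_mem _ (Finset.mem_filter.mpr ⟨hP, by omega⟩)
  rw [hQ] at this
  simp at this

theorem card_oddPoints_of_unramified (h : mapDegree φ = 5) {Q : OnePoint ℂ}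
    (hQ : ramificationData φ Q = 0) :
    5 ≤ (oddPoints φ Q).card + ramIndex φ Q OnePoint.infty := by
  classical
  have hsum := sum_ramIndex (φ := φ) Q
  rw [fiberSupport, Finset.sum_cons, Finset.sum_map, h] at hsum
  have hone : ∀ a ∈ (fiberPoly φ Q).roots.toFinset, ramIndex φ Q (a : OnePoint ℂ) = 1 := by
    intro a ha
    have h₁ := ramIndex_le_one_of_unramified (P := (a : OnePoint ℂ)) (by
      rw [fiberSupport]
      exact Finset.mem_cons_of_mem (Finset.mem_map_of_mem _ ha)) hQ
    have h₂ : 0 < ramIndex φ Q (a : OnePoint ℂ) := by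
      rw [Multiset.mem_toFinset] at ha
      have hne : fiberPoly φ Q ≠ 0 := fiberPoly_ne_zero (h.trans_ne (by norm_num)) Q
      exact (rootMultiplicity_pos hne).mpr (isRoot_of_mem_roots ha)
    omega
  have hodd : oddPoints φ Q = (fiberPoly φ Q).roots.toFinset :=
    Finset.filter_true_of_mem fun a ha => by
      have := hone a ha
      change (fiberPoly φ Q).rootMultiplicity a = 1 at this
      rw [this]
      exact odd_one
  have hsum' : ∑ a ∈ (fiberPoly φ Q).roots.toFinset, ramIndex φ Q (a : OnePoint ℂ)
      = (oddPoints φ Q).card := by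
    rw [Finset.sum_congr rfl hone, hodd, Finset.card_eq_sum_ones]
  rw [← hsum', add_comm]
  exact hsum.ge

/-- If `f` is, up to squares, the product of the fibre polynomials over four points and has degree
at most six, then these fibres have at most six finite points of odd multiplicity. -/
theorem sum_card_oddPoints_le (h : mapDegree φ = 5) {B : Fin 4 → OnePoint ℂ}
    (hB : Function.Injective B) {f r s : ℂ[X]} (hf : f.natDegree ≤ 6) (hr : r ≠ 0) (hs : s ≠ 0)
    (hf0 : f ≠ 0) (hrs : r ^ 2 * f = s ^ 2 * ∏ i, fiberPoly φ (B i)) :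
    ∑ i, (oddPoints φ (B i)).card ≤ 6 := by
  classical
  have h5 : mapDegree φ ≠ 0 := h.trans_ne (by norm_num)
  rw [← Finset.card_biUnion]
  · refine le_trans ?_ ((f.roots.toFinset_card_le.trans f.card_roots').trans hf)
    refine Finset.card_le_card fun a ha => ?_
    obtain ⟨i, -, hi⟩ := Finset.mem_biUnion.mp ha
    have hodd := odd_of_mem_oddPoints hi
    have hprod : ∏ i, fiberPoly φ (B i) ≠ 0 :=
      Finset.prod_ne_zero_iff.mpr fun i _ => fiberPoly_ne_zero h5 _
    have hmult : (∏ i, fiberPoly φ (B i)).rootMultiplicity a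
        = (fiberPoly φ (B i)).rootMultiplicity a := by
      rw [← count_roots, roots_prod _ _ hprod, Multiset.count_bind]
      change ∑ j, Multiset.count a (fiberPoly φ (B j)).roots = _
      rw [Finset.sum_eq_single i]
      · exact count_roots _
      · intro j _ hj
        rw [count_roots]
        by_contra hne
        exact hj (hB (eq_of_ramIndex_ne_zero (P := (a : OnePoint ℂ)) h5 hne hodd.pos.ne'))
      · intro hi; simp at hi
    have key := congrArg (rootMultiplicity a) hrs
    rw [rootMultiplicity_mul (mul_ne_zero (pow_ne_zero 2 hr) hf0),
      rootMultiplicity_mul (mul_ne_zero (pow_ne_zero 2 hs) hprod), hmult, pow_two, pow_two,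
      rootMultiplicity_mul (mul_ne_zero hr hr), rootMultiplicity_mul (mul_ne_zero hs hs)] at key
    have hodd' : Odd ((fiberPoly φ (B i)).rootMultiplicity a) := hodd
    rw [Multiset.mem_toFinset, mem_roots hf0, ← rootMultiplicity_pos hf0]
    obtain ⟨k, hk⟩ := hodd'
    omega
  · intro i _ j _ hij
    rw [Function.onFun, Finset.disjoint_left]
    intro a hi hj
    exact hij (hB (eq_of_ramIndex_ne_zero h5 (odd_of_mem_oddPoints hi).pos.ne'
      (odd_of_mem_oddPoints hj).pos.ne'))

/-- In the situation of `sum_card_oddPoints_le`, `φ` is ramified over each of the four points: each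
fibre has an odd number of points of odd multiplicity, an unramified one has five of them, and
`1 + 1 + 1 + 5 > 6`. -/
theorem ramificationData_ne_zero (h : mapDegree φ = 5) {B : Fin 4 → OnePoint ℂ}
    (hB : Function.Injective B) (hle : ∑ i, (oddPoints φ (B i)).card ≤ 6) (i : Fin 4) :
    ramificationData φ (B i) ≠ 0 := by
  classical
  intro hi
  have h5 : mapDegree φ ≠ 0 := h.trans_ne (by norm_num)
  let δ : Fin 4 → ℕ := fun j => if ramIndex φ (B j) OnePoint.infty ≠ 0 then 1 else 0
  have hδ : ∑ j, δ j ≤ 1 := by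
    rw [← Finset.card_filter, Finset.card_le_one]
    intro j hj k hk
    exact hB (eq_of_ramIndex_ne_zero h5 (Finset.mem_filter.mp hj).2 (Finset.mem_filter.mp hk).2)
  have hj (j : Fin 4) : (if j = i then 5 else 1) ≤ (oddPoints φ (B j)).card + δ j := by
    split_ifs with hji
    · subst hji
      have h₁ := card_oddPoints_of_unramified h hi
      have h₂ := ramIndex_le_one_of_unramified (P := OnePoint.infty)
        (Finset.mem_cons_self _ _) hi
      simp only [δ]
      split_ifs <;> omega
    · simp only [δ]
      split_ifs with h0
      · omega
      · exact (one_le_card_oddPoints h (not_not.mp h0)).trans (Nat.le_add_right _ _)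
  have hsum := Finset.sum_le_sum fun j (_ : j ∈ Finset.univ) => hj j
  rw [Finset.sum_add_distrib] at hsum
  have h8 : ∑ j : Fin 4, (if j = i then 5 else 1) = 8 := by
    fin_cases i <;> rfl
  omega

theorem exists_branch_enumeration (E : WeierstrassCurve ℂ) [E.IsElliptic] (φ : RatFunc ℂ) :
    ∃ B : Fin 4 → OnePoint ℂ, Function.Injective B ∧ (∃ i, B i = OnePoint.infty) ∧
      (∀ i, B i = OnePoint.infty ∨ ∃ e : ℂ, B i = e ∧ (twoTorsionPoly E).IsRoot e) ∧
      homogenizedTwoTorsion E φ.num φ.denom * φ.denom = C 4 * ∏ i, fiberPoly φ (B i) := by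
  obtain ⟨e₁, e₂, e₃, h₁₂, h₁₃, h₂₃, hg⟩ := exists_distinct_roots_twoTorsionPoly E
  have r₁ : (twoTorsionPoly E).IsRoot e₁ := by rw [hg]; simp
  have r₂ : (twoTorsionPoly E).IsRoot e₂ := by rw [hg]; simp
  have r₃ : (twoTorsionPoly E).IsRoot e₃ := by rw [hg]; simp
  obtain ⟨hb₂, hb₄, hb₆⟩ := eq_twoTorsion_coeffs_of_roots h₁₂ h₁₃ h₂₃ r₁ r₂ r₃
  refine ⟨![e₁, e₂, e₃, OnePoint.infty], ?_, ⟨3, rfl⟩, ?_, ?_⟩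
  · intro i j hij
    have c₁₂ : (e₁ : OnePoint ℂ) ≠ e₂ := OnePoint.coe_injective.ne h₁₂
    have c₁₃ : (e₁ : OnePoint ℂ) ≠ e₃ := OnePoint.coe_injective.ne h₁₃
    have c₂₃ : (e₂ : OnePoint ℂ) ≠ e₃ := OnePoint.coe_injective.ne h₂₃
    fin_cases i <;> fin_cases j <;> first | rfl | simp_all
  · intro i
    fin_cases i
    · exact Or.inr ⟨e₁, rfl, r₁⟩
    · exact Or.inr ⟨e₂, rfl, r₂⟩
    · exact Or.inr ⟨e₃, rfl, r₃⟩
    · exact Or.inl rfl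
  · rw [Fin.prod_univ_four]
    change _ = C 4 * ((φ.num - C e₁ * φ.denom) * (φ.num - C e₂ * φ.denom)
      * (φ.num - C e₃ * φ.denom) * φ.denom)
    rw [homogenizedTwoTorsion, hb₂, hb₄, hb₆]
    simp only [map_mul, map_add, map_neg, map_ofNat]
    ring

/-- The four branch points of `φ` are the branch points of `π_E`: the `z`-coordinates of the points
of order two, and infinity. -/
theorem branchPoints_eq {K : Type*} [Field K] [Algebra ℂ K] {f : ℂ[X]} {x y : K}
    (hC : IsGenusTwoCurve f x y) {E : WeierstrassCurve ℂ} [E.IsElliptic]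
    {ψ : E.toAffine.FunctionField →ₐ[ℂ] K} (hψ : coverDegree ψ = 5)
    (hφ : IsFreyKaniCover x ψ φ) {q : Fin 4 → OnePoint ℂ}
    (hun : ∀ Q, Q ∉ Set.range q → ramificationData φ Q = 0) :
    (∃ i, q i = OnePoint.infty) ∧
      (∀ i, q i = OnePoint.infty ∨ ∃ e : ℂ, q i = e ∧ (twoTorsionPoly E).IsRoot e) ∧
      homogenizedTwoTorsion E φ.num φ.denom * φ.denom = C 4 * ∏ i, fiberPoly φ (q i) := by
  obtain ⟨B, hB, ⟨j, hj⟩, hBE, hprod⟩ := exists_branch_enumeration E φ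
  have hdeg := mapDegree_eq_five hC hψ hφ
  obtain ⟨r, s, hr, hs, hrs⟩ := exists_sq_mul_eq hC hψ hφ
  have hle : ∑ i, (oddPoints φ (B i)).card ≤ 6 := by
    refine sum_card_oddPoints_le hdeg hB (f := f) (r := r) (s := C 2 * s) ?_ hr
      (mul_ne_zero (C_ne_zero.mpr two_ne_zero) hs) hC.squarefree.ne_zero ?_
    · rcases hC.natDegree with h | h <;> omega
    · rw [hrs, hprod, show (4 : ℂ) = 2 * 2 by norm_num, map_mul]
      ring
  have hmem (i : Fin 4) : B i ∈ Set.range q := by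
    by_contra hi
    exact ramificationData_ne_zero hdeg hB hle i (hun _ hi)
  choose σ hσ using hmem
  have hσi : Function.Bijective σ := Finite.injective_iff_bijective.mp fun i j hij =>
    hB (by rw [← hσ i, ← hσ j, hij])
  refine ⟨⟨σ j, by rw [hσ, hj]⟩, ?_, ?_⟩
  · intro i
    obtain ⟨j, rfl⟩ := hσi.surjective i
    rw [hσ]
    exact hBE j
  · rw [hprod, ← hσi.prod_comp fun i => fiberPoly φ (q i)]
    simp only [hσ]

end BranchPoints

/-! ### Normal form of the covering -/

/-- The fibre polynomials of a map of type II, iii) of degree five, in the coordinate `z` for which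
the point of index four is at infinity and the simple points of the two fibres with ramification
`2, 2` are `0` and `1`. The points of index two over `q 0`, `q 1` and `q 3` are `α₁, α₂`, `β₁, β₂`
and `g`, and the simple points over `q 2` and `q 3` are `d` and `ρ₁, ρ₂, ρ₃`. The function `D` is
the linear form in `x` vanishing at the point of index four, up to a constant. -/
structure NormalFibres {K : Type*} [Field K] [Algebra ℂ K] (x z D : K) (φ : RatFunc ℂ)
    (q : Fin 4 → OnePoint ℂ) (α₁ α₂ β₁ β₂ d g ρ₁ ρ₂ ρ₃ : ℂ) (κ : Fin 4 → ℂ) : Prop where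
  adjoin_eq : IntermediateField.adjoin ℂ {z} = IntermediateField.adjoin ℂ {x}
  transcendental : Transcendental ℂ z
  ne_zero : D ≠ 0
  mem : D ∈ IntermediateField.adjoin ℂ {x}
  const_ne_zero : ∀ i, κ i ≠ 0
  fibre₀ : aeval x (fiberPoly φ (q 0)) =
    D ^ 5 * aeval z (C (κ 0) * (X * ((X - C α₁) * (X - C α₂)) ^ 2))
  fibre₁ : aeval x (fiberPoly φ (q 1)) =
    D ^ 5 * aeval z (C (κ 1) * ((X - 1) * ((X - C β₁) * (X - C β₂)) ^ 2))
  fibre₂ : aeval x (fiberPoly φ (q 2)) = D ^ 5 * aeval z (C (κ 2) * (X - C d))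
  fibre₃ : aeval x (fiberPoly φ (q 3)) =
    D ^ 5 * aeval z (C (κ 3) * ((X - C g) ^ 2 * ((X - C ρ₁) * (X - C ρ₂) * (X - C ρ₃))))
  injective : Function.Injective ![0, 1, d, ρ₁, ρ₂, ρ₃]
  ne_α : g ≠ α₁ ∧ g ≠ α₂
  ne_β : g ≠ β₁ ∧ g ≠ β₂

/-- The normalizing coordinate exists for every map of degree five of type II, iii). -/
theorem exists_normalFibres {K : Type*} [Field K] [Algebra ℂ K] {x : K}
    (hx : Transcendental ℂ x) {φ : RatFunc ℂ} (h : mapDegree φ = 5) {q : Fin 4 → OnePoint ℂ}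
    (hq : Function.Injective q) (h₀ : ramificationData φ (q 0) = Multiset.replicate 2 2)
    (h₁ : ramificationData φ (q 1) = Multiset.replicate 2 2)
    (h₂ : ramificationData φ (q 2) = {4}) (h₃ : ramificationData φ (q 3) = {2}) :
    ∃ (z D : K) (α₁ α₂ β₁ β₂ d g ρ₁ ρ₂ ρ₃ : ℂ) (κ : Fin 4 → ℂ),
      NormalFibres x z D φ q α₁ α₂ β₁ β₂ d g ρ₁ ρ₂ ρ₃ κ := by
  have h5 : mapDegree φ ≠ 0 := h.trans_ne (by norm_num)
  obtain ⟨A₁, A₂, P₀, c₀, hc₀, -, rA₁, rA₂, rP₀, e₀⟩ := exists_fiberPoly_eq_of_two_two h h₀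
  obtain ⟨B₁, B₂, P₁, c₁, hc₁, -, rB₁, rB₂, rP₁, e₁⟩ := exists_fiberPoly_eq_of_two_two h h₁
  obtain ⟨Pinf, Pd, c₂, hc₂, rPinf, rPd, e₂⟩ := exists_fiberPoly_eq_of_four h h₂
  obtain ⟨G, R₁, R₂, R₃, c₃, hc₃, R₁₂, R₁₃, R₂₃, rG, rR₁, rR₂, rR₃, e₃⟩ :=
    exists_fiberPoly_eq_of_two h h₃
  -- Points in different fibres are distinct, and so are points of different multiplicity.
  have hdist {i j : Fin 4} (hij : i ≠ j) {P P' : OnePoint ℂ} (hP : ramIndex φ (q i) P ≠ 0)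
      (hP' : ramIndex φ (q j) P' ≠ 0) : P ≠ P' := by
    rintro rfl
    exact hij (hq (eq_of_ramIndex_ne_zero h5 hP hP'))
  have hdist' {i : Fin 4} {P P' : OnePoint ℂ} (hP : ramIndex φ (q i) P ≠ ramIndex φ (q i) P') :
      P ≠ P' := by
    rintro rfl
    exact hP rfl
  have nA₁ : A₁ ≠ Pinf := hdist (i := 0) (j := 2) (by decide) (by omega) (by omega)
  have nA₂ : A₂ ≠ Pinf := hdist (i := 0) (j := 2) (by decide) (by omega) (by omega)
  have nP₀ : P₀ ≠ Pinf := hdist (i := 0) (j := 2) (by decide) (by omega) (by omega)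
  have nB₁ : B₁ ≠ Pinf := hdist (i := 1) (j := 2) (by decide) (by omega) (by omega)
  have nB₂ : B₂ ≠ Pinf := hdist (i := 1) (j := 2) (by decide) (by omega) (by omega)
  have nP₁ : P₁ ≠ Pinf := hdist (i := 1) (j := 2) (by decide) (by omega) (by omega)
  have nPd : Pd ≠ Pinf := hdist' (i := 2) (by omega)
  have nG : G ≠ Pinf := hdist (i := 3) (j := 2) (by decide) (by omega) (by omega)
  have nR₁ : R₁ ≠ Pinf := hdist (i := 3) (j := 2) (by decide) (by omega) (by omega)
  have nR₂ : R₂ ≠ Pinf := hdist (i := 3) (j := 2) (by decide) (by omega) (by omega)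
  have nR₃ : R₃ ≠ Pinf := hdist (i := 3) (j := 2) (by decide) (by omega) (by omega)
  have n₀₁ : P₀ ≠ P₁ := hdist (i := 0) (j := 1) (by decide) (by omega) (by omega)
  obtain ⟨z, D, m, hz, m₀, m₁⟩ := exists_isLineCoordinate_zero_one hx nP₀ nP₁ n₀₁
  obtain ⟨kinf, hkinf, linf⟩ := hz.pole
  obtain ⟨kA₁, hkA₁, lA₁⟩ := hz.point A₁ nA₁
  obtain ⟨kA₂, hkA₂, lA₂⟩ := hz.point A₂ nA₂
  obtain ⟨kP₀, hkP₀, lP₀⟩ := hz.point P₀ nP₀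
  obtain ⟨kB₁, hkB₁, lB₁⟩ := hz.point B₁ nB₁
  obtain ⟨kB₂, hkB₂, lB₂⟩ := hz.point B₂ nB₂
  obtain ⟨kP₁, hkP₁, lP₁⟩ := hz.point P₁ nP₁
  obtain ⟨kPd, hkPd, lPd⟩ := hz.point Pd nPd
  obtain ⟨kG, hkG, lG⟩ := hz.point G nG
  obtain ⟨kR₁, hkR₁, lR₁⟩ := hz.point R₁ nR₁
  obtain ⟨kR₂, hkR₂, lR₂⟩ := hz.point R₂ nR₂
  obtain ⟨kR₃, hkR₃, lR₃⟩ := hz.point R₃ nR₃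
  rw [m₀, map_zero, sub_zero] at lP₀
  rw [m₁, map_one] at lP₁
  have hinj : Function.Injective (![P₀, P₁, Pd, R₁, R₂, R₃] : Fin 6 → OnePoint ℂ) := by
    have n₀d : P₀ ≠ Pd := hdist (i := 0) (j := 2) (by decide) (by omega) (by omega)
    have n₁d : P₁ ≠ Pd := hdist (i := 1) (j := 2) (by decide) (by omega) (by omega)
    have n₀R {R : OnePoint ℂ} (hR : ramIndex φ (q 3) R = 1) : P₀ ≠ R :=
      hdist (i := 0) (j := 3) (by decide) (by omega) (by omega)
    have n₁R {R : OnePoint ℂ} (hR : ramIndex φ (q 3) R = 1) : P₁ ≠ R :=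
      hdist (i := 1) (j := 3) (by decide) (by omega) (by omega)
    have ndR {R : OnePoint ℂ} (hR : ramIndex φ (q 3) R = 1) : Pd ≠ R :=
      hdist (i := 2) (j := 3) (by decide) (by omega) (by omega)
    rw [← List.nodup_ofFn]
    simp [n₀₁, n₀d, n₁d, n₀R rR₁, n₀R rR₂, n₀R rR₃, n₁R rR₁, n₁R rR₂, n₁R rR₃, ndR rR₁,
      ndR rR₂, ndR rR₃, R₁₂, R₁₃, R₂₃]
  refine ⟨z, D, m A₁, m A₂, m B₁, m B₂, m Pd, m G, m R₁, m R₂, m R₃,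
    ![c₀ * kA₁ ^ 2 * kA₂ ^ 2 * kP₀, c₁ * kB₁ ^ 2 * kB₂ ^ 2 * kP₁, c₂ * kinf ^ 4 * kPd,
      c₃ * kG ^ 2 * kR₁ * kR₂ * kR₃], hz.adjoin_eq, hz.transcendental hx, hz.ne_zero, ?_, ?_, ?_,
      ?_, ?_, ?_, ?_, ?_, ?_⟩
  · have hD : D = aeval x (pointPoly Pinf) / algebraMap ℂ K kinf := by
      rw [linf]
      field_simp [(_root_.map_ne_zero (algebraMap ℂ K)).mpr hkinf]
    rw [hD]
    exact div_mem (aeval_mem_intermediateField (IntermediateField.mem_adjoin_simple_self ℂ x) _)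
      (IntermediateField.algebraMap_mem _ _)
  · intro i
    fin_cases i <;> simp_all
  · rw [e₀]
    simp only [map_mul, map_pow, map_sub, aeval_X, aeval_C, lA₁, lA₂, lP₀, Matrix.cons_val]
    ring
  · rw [e₁]
    simp only [map_mul, map_pow, map_sub, map_one, aeval_X, aeval_C, lB₁, lB₂, lP₁,
      Matrix.cons_val]
    ring
  · rw [e₂]
    simp only [map_mul, map_pow, map_sub, aeval_X, aeval_C, linf, lPd, Matrix.cons_val]
    ring
  · rw [e₃]
    simp only [map_mul, map_pow, map_sub, aeval_X, aeval_C, lG, lR₁, lR₂, lR₃, Matrix.cons_val]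
    ring
  · have hm : ![0, 1, m Pd, m R₁, m R₂, m R₃] = m ∘ ![P₀, P₁, Pd, R₁, R₂, R₃] := by
      ext i
      fin_cases i <;> simp [m₀, m₁]
    have hne : ∀ i, (![P₀, P₁, Pd, R₁, R₂, R₃] : Fin 6 → OnePoint ℂ) i ≠ Pinf := by
      intro i
      fin_cases i <;> assumption
    rw [hm]
    exact fun i j hij => hinj (hz.injOn _ _ (hne i) (hne j) hij)
  · exact ⟨fun e => hdist (i := 3) (j := 0) (by decide) (by omega) (by omega)
      (hz.injOn G A₁ nG nA₁ e), fun e => hdist (i := 3) (j := 0) (by decide) (by omega) (by omega)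
      (hz.injOn G A₂ nG nA₂ e)⟩
  · exact ⟨fun e => hdist (i := 3) (j := 1) (by decide) (by omega) (by omega)
      (hz.injOn G B₁ nG nB₁ e), fun e => hdist (i := 3) (j := 1) (by decide) (by omega) (by omega)
      (hz.injOn G B₂ nG nB₂ e)⟩

/-! ### The cross ratio of the branch points -/

/-- The coefficients `(λ, μ)` of the fibre polynomial `λ p + μ q` over a point of the target line,
where `φ = p / q` in lowest terms. -/
noncomputable def fiberVec : OnePoint ℂ → ℂ × ℂ
  | none => (0, 1)
  | some c => (1, -c)

/-- The determinant of the coefficient vectors of two fibre polynomials. It is the difference of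
the points if both are finite, and `±1` if exactly one of them is infinite. -/
noncomputable def fiberDet (Q Q' : OnePoint ℂ) : ℂ :=
  (fiberVec Q).1 * (fiberVec Q').2 - (fiberVec Q).2 * (fiberVec Q').1

theorem fiberDet_coe_coe (c c' : ℂ) : fiberDet (c : OnePoint ℂ) c' = c - c' := by
  change 1 * -c' - -c * 1 = _
  ring

theorem fiberDet_infty_coe (c : ℂ) : fiberDet OnePoint.infty (c : OnePoint ℂ) = -1 := by
  change 0 * -c - 1 * 1 = _
  ring

theorem fiberDet_coe_infty (c : ℂ) : fiberDet (c : OnePoint ℂ) OnePoint.infty = 1 := by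
  change 1 * 1 - -c * 0 = _
  ring

theorem fiberDet_ne_zero {Q Q' : OnePoint ℂ} (h : Q ≠ Q') : fiberDet Q Q' ≠ 0 := by
  induction Q using OnePoint.rec with
  | infty =>
    induction Q' using OnePoint.rec with
    | infty => exact absurd rfl h
    | coe c' => rw [fiberDet_infty_coe]; norm_num
  | coe c =>
    induction Q' using OnePoint.rec with
    | infty => rw [fiberDet_coe_infty]; norm_num
    | coe c' =>
      rw [fiberDet_coe_coe]
      exact sub_ne_zero.mpr fun h' => h (by rw [h'])

/-- Any three fibre polynomials are linearly dependent, as they lie in the pencil spanned by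
numerator and denominator. -/
theorem fiberDet_relation (φ : RatFunc ℂ) (Q Q' Q'' : OnePoint ℂ) :
    C (fiberDet Q' Q'') * fiberPoly φ Q + C (fiberDet Q'' Q) * fiberPoly φ Q'
      + C (fiberDet Q Q') * fiberPoly φ Q'' = 0 := by
  have h (Q : OnePoint ℂ) : fiberPoly φ Q =
      C (fiberVec Q).1 * φ.num + C (fiberVec Q).2 * φ.denom := by
    rcases Q with _ | c
    · simp [fiberPoly_none, fiberVec]
    · simp [fiberPoly_some, fiberVec, sub_eq_add_neg]
  rw [h Q, h Q', h Q'']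
  simp only [fiberDet, map_sub, map_mul]
  ring

/-- The cross ratio of the four branch points is a Legendre parameter of the elliptic curve. -/
theorem exists_variableChange_crossRatio (E : WeierstrassCurve ℂ) {q : Fin 4 → OnePoint ℂ}
    (hq : Function.Injective q)
    (hE : ∀ i, q i = OnePoint.infty ∨ ∃ e : ℂ, q i = e ∧ (twoTorsionPoly E).IsRoot e)
    (hinf : ∃ i, q i = OnePoint.infty) :
    ∃ c : WeierstrassCurve.VariableChange ℂ, c • E = legendreCurve
      (fiberDet (q 0) (q 3) * fiberDet (q 1) (q 2)
        / (fiberDet (q 3) (q 2) * fiberDet (q 0) (q 1))) := by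
  obtain ⟨i, hi⟩ := hinf
  have hfin (j : Fin 4) (hj : j ≠ i) : ∃ e : ℂ, q j = e ∧ (twoTorsionPoly E).IsRoot e :=
    (hE j).resolve_left fun h => hj (hq (h.trans hi.symm))
  have hne {j k : Fin 4} (hjk : j ≠ k) {a b : ℂ} (ha : q j = a) (hb : q k = b) : a ≠ b := by
    rintro rfl
    exact hjk (hq (ha.trans hb.symm))
  fin_cases i
  · obtain ⟨a, ha, ra⟩ := hfin 1 (by decide)
    obtain ⟨b, hb, rb⟩ := hfin 2 (by decide)
    obtain ⟨c, hc, rc⟩ := hfin 3 (by decide)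
    have hi : q 0 = OnePoint.infty := hi
    rw [hi, ha, hb, hc]
    simp only [fiberDet_coe_coe, fiberDet_infty_coe, mul_neg_one, neg_one_mul, neg_div_neg_eq]
    exact exists_variableChange_legendreCurve E (hne (by decide) ha hc) (hne (by decide) ha hb)
      (hne (by decide) hc hb) ra rc rb
  · obtain ⟨a, ha, ra⟩ := hfin 0 (by decide)
    obtain ⟨b, hb, rb⟩ := hfin 2 (by decide)
    obtain ⟨c, hc, rc⟩ := hfin 3 (by decide)
    have hi : q 1 = OnePoint.infty := hi
    rw [hi, ha, hb, hc]
    simp only [fiberDet_coe_coe, fiberDet_infty_coe, fiberDet_coe_infty, mul_neg_one, mul_one,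
      neg_sub]
    rw [← neg_div_neg_eq, neg_sub, neg_sub]
    exact exists_variableChange_legendreCurve E (hne (by decide) ha hb) (hne (by decide) ha hc)
      (hne (by decide) hb hc) ra rb rc
  · obtain ⟨a, ha, ra⟩ := hfin 0 (by decide)
    obtain ⟨b, hb, rb⟩ := hfin 1 (by decide)
    obtain ⟨c, hc, rc⟩ := hfin 3 (by decide)
    have hi : q 2 = OnePoint.infty := hi
    rw [hi, ha, hb, hc]
    simp only [fiberDet_coe_coe, fiberDet_coe_infty, mul_one, one_mul]
    rw [← neg_div_neg_eq, neg_sub, neg_sub]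
    exact exists_variableChange_legendreCurve E (hne (by decide) hc hb) (hne (by decide) hc ha)
      (hne (by decide) hb ha) rc rb ra
  · obtain ⟨a, ha, ra⟩ := hfin 0 (by decide)
    obtain ⟨b, hb, rb⟩ := hfin 1 (by decide)
    obtain ⟨c, hc, rc⟩ := hfin 2 (by decide)
    have hi : q 3 = OnePoint.infty := hi
    rw [hi, ha, hb, hc]
    simp only [fiberDet_coe_coe, fiberDet_infty_coe, fiberDet_coe_infty, neg_one_mul, one_mul]
    rw [← neg_div_neg_eq, neg_neg, neg_sub]
    exact exists_variableChange_legendreCurve E (hne (by decide) hc ha) (hne (by decide) hc hb)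
      (hne (by decide) ha hb) rc ra rb

/-! ### Identities between the fibre polynomials -/

section Normal

variable {K : Type*} [Field K] [Algebra ℂ K] {x z D : K} {φ : RatFunc ℂ}
  {q : Fin 4 → OnePoint ℂ} {α₁ α₂ β₁ β₂ d g ρ₁ ρ₂ ρ₃ : ℂ} {κ : Fin 4 → ℂ}

/-- In a linear relation between two monic polynomials of degree five and a linear polynomial, the
coefficients of the former cancel, so that their difference is a multiple of the latter. -/
theorem eval_sub_eval_eq_of_relation {P P' : ℂ[X]} (hP : P.Monic) (hP' : P'.Monic)
    (hd : P.natDegree = 5) (hd' : P'.natDegree = 5) {a b c : ℂ} (ha : a ≠ 0)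
    (h : C a * P + C b * P' + C c * (X - C d) = 0) (w : ℂ) :
    P.eval w - P'.eval w = -c / a * (w - d) := by
  have h5 := congrArg (fun R => coeff R 5) h
  have e : P.coeff 5 = 1 := by rw [← hd]; exact hP
  have e' : P'.coeff 5 = 1 := by rw [← hd']; exact hP'
  have e'' : (X - C d).coeff 5 = 0 := by
    rw [coeff_eq_zero_of_natDegree_lt]
    rw [natDegree_X_sub_C]; norm_num
  simp only [coeff_add, coeff_C_mul, e, e', e'', coeff_zero] at h5
  have hw := congrArg (eval w) h
  simp only [eval_add, eval_mul, eval_C, eval_sub, eval_X, eval_zero] at hw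
  field_simp
  linear_combination hw - eval w P' * h5

/-- The linear relations between the fibre polynomials, normalized by comparing leading
coefficients. -/
theorem NormalFibres.exists_identities (hN : NormalFibres x z D φ q α₁ α₂ β₁ β₂ d g ρ₁ ρ₂ ρ₃ κ)
    (hq : Function.Injective q) :
    ∃ δ k : ℂ, δ ≠ 0 ∧
      k / δ = fiberDet (q 0) (q 3) * fiberDet (q 1) (q 2)
        / (fiberDet (q 3) (q 2) * fiberDet (q 0) (q 1)) ∧
      (∀ w : ℂ, w * ((w - α₁) * (w - α₂)) ^ 2 - (w - 1) * ((w - β₁) * (w - β₂)) ^ 2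
        = δ * (w - d)) ∧
      ∀ w : ℂ, w * ((w - α₁) * (w - α₂)) ^ 2
        - (w - g) ^ 2 * ((w - ρ₁) * (w - ρ₂) * (w - ρ₃)) = k * (w - d) := by
  have hκ := hN.const_ne_zero
  have hD : D ^ 5 ≠ 0 := pow_ne_zero 5 hN.ne_zero
  have d₁₂ := fiberDet_ne_zero (hq.ne (show (1 : Fin 4) ≠ 2 by decide))
  have d₃₂ := fiberDet_ne_zero (hq.ne (show (3 : Fin 4) ≠ 2 by decide))
  have d₀₁ := fiberDet_ne_zero (hq.ne (show (0 : Fin 4) ≠ 1 by decide))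
  have hrel₁ := congrArg (aeval x) (fiberDet_relation φ (q 0) (q 1) (q 2))
  have hrel₃ := congrArg (aeval x) (fiberDet_relation φ (q 0) (q 3) (q 2))
  simp only [map_add, map_mul _ (C _), hN.fibre₀, hN.fibre₁, hN.fibre₂, hN.fibre₃, aeval_C,
    map_zero] at hrel₁ hrel₃
  have m₀ : (X * ((X - C α₁) * (X - C α₂)) ^ 2).Monic := by monicity!
  have m₁ : ((X - 1) * ((X - C β₁) * (X - C β₂)) ^ 2).Monic := by monicity!
  have m₃ : ((X - C g) ^ 2 * ((X - C ρ₁) * (X - C ρ₂) * (X - C ρ₃))).Monic := by monicity!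
  have n₀ : (X * ((X - C α₁) * (X - C α₂)) ^ 2).natDegree = 5 := by compute_degree!
  have n₁ : ((X - 1) * ((X - C β₁) * (X - C β₂)) ^ 2 : ℂ[X]).natDegree = 5 := by compute_degree!
  have n₃ : ((X - C g) ^ 2 * ((X - C ρ₁) * (X - C ρ₂) * (X - C ρ₃))).natDegree = 5 := by
    compute_degree!
  have p₁ : C (fiberDet (q 1) (q 2) * κ 0) * (X * ((X - C α₁) * (X - C α₂)) ^ 2)
      + C (fiberDet (q 2) (q 0) * κ 1) * ((X - 1) * ((X - C β₁) * (X - C β₂)) ^ 2)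
      + C (fiberDet (q 0) (q 1) * κ 2) * (X - C d) = 0 := by
    apply aeval_injective_of_transcendental hN.transcendental
    apply mul_left_cancel₀ hD
    simp only [map_add, map_mul, map_zero, mul_zero, aeval_C] at hrel₁ ⊢
    linear_combination hrel₁
  have p₃ : C (fiberDet (q 3) (q 2) * κ 0) * (X * ((X - C α₁) * (X - C α₂)) ^ 2)
      + C (fiberDet (q 2) (q 0) * κ 3)
        * ((X - C g) ^ 2 * ((X - C ρ₁) * (X - C ρ₂) * (X - C ρ₃)))
      + C (fiberDet (q 0) (q 3) * κ 2) * (X - C d) = 0 := by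
    apply aeval_injective_of_transcendental hN.transcendental
    apply mul_left_cancel₀ hD
    simp only [map_add, map_mul, map_zero, mul_zero, aeval_C] at hrel₃ ⊢
    linear_combination hrel₃
  refine ⟨-(fiberDet (q 0) (q 1) * κ 2) / (fiberDet (q 1) (q 2) * κ 0),
    -(fiberDet (q 0) (q 3) * κ 2) / (fiberDet (q 3) (q 2) * κ 0), ?_, ?_, fun w => ?_, fun w => ?_⟩
  · exact div_ne_zero (neg_ne_zero.mpr (mul_ne_zero d₀₁ (hκ 2))) (mul_ne_zero d₁₂ (hκ 0))
  · have := hκ 0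
    have := hκ 2
    field_simp
  · have := eval_sub_eval_eq_of_relation m₀ m₁ n₀ n₁ (mul_ne_zero d₁₂ (hκ 0)) p₁ w
    simpa using this
  · have := eval_sub_eval_eq_of_relation m₀ m₃ n₀ n₃ (mul_ne_zero d₃₂ (hκ 0)) p₃ w
    simpa using this

end Normal

/-! ### The normal form of the genus two curve -/

theorem normalSextic_eq_prod (d ρ₁ ρ₂ ρ₃ : ℂ) :
    normalSextic (ρ₁ + ρ₂ + ρ₃) (ρ₁ * ρ₂ + ρ₁ * ρ₃ + ρ₂ * ρ₃) d (ρ₁ * ρ₂ * ρ₃) =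
      ∏ i, (X - C ((![0, 1, d, ρ₁, ρ₂, ρ₃] : Fin 6 → ℂ) i)) := by
  rw [normalSextic, Fin.prod_univ_six]
  simp only [Matrix.cons_val, map_add, map_mul, map_zero, map_one]
  ring

theorem squarefree_normalSextic {d ρ₁ ρ₂ ρ₃ : ℂ}
    (h : Function.Injective (![0, 1, d, ρ₁, ρ₂, ρ₃] : Fin 6 → ℂ)) :
    Squarefree (normalSextic (ρ₁ + ρ₂ + ρ₃) (ρ₁ * ρ₂ + ρ₁ * ρ₃ + ρ₂ * ρ₃) d (ρ₁ * ρ₂ * ρ₃)) := by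
  rw [normalSextic_eq_prod]
  exact (separable_prod_X_sub_C_iff.mpr h).squarefree

theorem natDegree_normalSextic (u v d w : ℂ) : (normalSextic u v d w).natDegree = 6 := by
  rw [normalSextic]
  compute_degree!

section Model

variable {K : Type*} [Field K] [Algebra ℂ K]

/-- The normal form of `C`: the function `ψ(2 y + a₁ z + a₃)`, multiplied by a rational function of
`x` that removes all squares, is the second coordinate. -/
theorem NormalFibres.exists_isGenusTwoCurve {f : ℂ[X]} {x y z D : K} {E : WeierstrassCurve ℂ}
    {ψ : E.toAffine.FunctionField →ₐ[ℂ] K} {φ : RatFunc ℂ} {q : Fin 4 → OnePoint ℂ}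
    {α₁ α₂ β₁ β₂ d g ρ₁ ρ₂ ρ₃ : ℂ} {κ : Fin 4 → ℂ}
    (hN : NormalFibres x z D φ q α₁ α₂ β₁ β₂ d g ρ₁ ρ₂ ρ₃ κ) (hC : IsGenusTwoCurve f x y)
    (hψ : coverDegree ψ = 5) (hφ : IsFreyKaniCover x ψ φ)
    (hprod : homogenizedTwoTorsion E φ.num φ.denom * φ.denom = C 4 * ∏ i, fiberPoly φ (q i)) :
    ∃ y' : K, IsGenusTwoCurve (normalSextic (ρ₁ + ρ₂ + ρ₃) (ρ₁ * ρ₂ + ρ₁ * ρ₃ + ρ₂ * ρ₃) d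
      (ρ₁ * ρ₂ * ρ₃)) z y' := by
  obtain ⟨c, hc⟩ := IsAlgClosed.exists_pow_nat_eq (4 * (κ 0 * κ 1 * κ 2 * κ 3)) two_pos
  have hκ := hN.const_ne_zero
  have hc0 : c ≠ 0 := by
    rintro rfl
    rw [zero_pow two_ne_zero] at hc
    have := hκ 0
    have := hκ 1
    have := hκ 2
    have := hκ 3
    simp_all
  have hq0 := aeval_ne_zero_of_transcendental hC.transcendental φ.denom_ne_zero
  have hD := hN.ne_zero
  set H : ℂ[X] := C c * ((X - C α₁) * (X - C α₂) * ((X - C β₁) * (X - C β₂)) * (X - C g)) with hH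
  have hH0 : aeval z H ≠ 0 := by
    refine aeval_ne_zero_of_transcendental hN.transcendental ?_
    simp [hH, hc0, X_sub_C_ne_zero]
  have hη := completedYCoord_sq_mul (E := E) (ψ := ψ) hC hφ
  set η := ψ (completedYCoord E) with hηdef
  set y' := η * aeval x φ.denom ^ 2 / (D ^ 10 * aeval z H) with hy'
  have hS : ∀ p : ℂ[X], aeval x p ∈ IntermediateField.adjoin ℂ {z, y'} := by
    intro p
    have hle : IntermediateField.adjoin ℂ {x} ≤ IntermediateField.adjoin ℂ {z, y'} := by
      rw [← hN.adjoin_eq]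
      exact IntermediateField.adjoin.mono _ _ _ (by simp)
    exact hle (aeval_mem_intermediateField (IntermediateField.mem_adjoin_simple_self ℂ x) p)
  refine ⟨y', squarefree_normalSextic hN.injective, Or.inr (natDegree_normalSextic _ _ _ _),
    hN.transcendental, ?_, ?_⟩
  · have key : η ^ 2 * aeval x φ.denom ^ 4 = D ^ 20 * aeval z (H ^ 2 *
        normalSextic (ρ₁ + ρ₂ + ρ₃) (ρ₁ * ρ₂ + ρ₁ * ρ₃ + ρ₂ * ρ₃) d (ρ₁ * ρ₂ * ρ₃)) := by
      rw [hη, hprod, Fin.prod_univ_four]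
      simp only [map_mul _ (C (4 : ℂ)), map_mul _ _ (fiberPoly φ _), hN.fibre₀, hN.fibre₁,
        hN.fibre₂, hN.fibre₃]
      have hH2 : H ^ 2 * normalSextic (ρ₁ + ρ₂ + ρ₃) (ρ₁ * ρ₂ + ρ₁ * ρ₃ + ρ₂ * ρ₃) d
          (ρ₁ * ρ₂ * ρ₃) = C 4 * ((C (κ 0) * (X * ((X - C α₁) * (X - C α₂)) ^ 2))
            * (C (κ 1) * ((X - 1) * ((X - C β₁) * (X - C β₂)) ^ 2)) * (C (κ 2) * (X - C d))
            * (C (κ 3) * ((X - C g) ^ 2 * ((X - C ρ₁) * (X - C ρ₂) * (X - C ρ₃))))) := by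
        have hcC := congrArg C hc
        simp only [map_mul, map_pow] at hcC
        rw [hH, mul_pow, hcC, normalSextic_eq_prod, Fin.prod_univ_six]
        simp only [Matrix.cons_val, map_zero, map_one, sub_zero]
        -- The linear factors are treated as atoms: expanding their product is very costly.
        generalize X - C α₁ = a₁, X - C α₂ = a₂, X - C β₁ = b₁, X - C β₂ = b₂, X - C d = l,
          X - C g = m, X - C ρ₁ = r₁, X - C ρ₂ = r₂, X - C ρ₃ = r₃, (X - 1 : ℂ[X]) = n
        ring
      rw [hH2]
      simp only [map_mul (aeval z), aeval_C]
      ring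
    rw [hy', div_pow, div_eq_iff (pow_ne_zero 2 (mul_ne_zero (pow_ne_zero 10 hD) hH0))]
    rw [map_mul, map_pow] at key
    linear_combination key
  · rw [eq_top_iff, ← hC.generates, IntermediateField.adjoin_le_iff]
    have hxS : x ∈ IntermediateField.adjoin ℂ {z, y'} := by simpa using hS X
    have hzS : z ∈ IntermediateField.adjoin ℂ {z, y'} :=
      IntermediateField.subset_adjoin _ _ (by simp)
    have hyS : y' ∈ IntermediateField.adjoin ℂ {z, y'} :=
      IntermediateField.subset_adjoin _ _ (by simp)
    have hDS : D ∈ IntermediateField.adjoin ℂ {z, y'} := by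
      have hle : IntermediateField.adjoin ℂ {x} ≤ IntermediateField.adjoin ℂ {z, y'} := by
        rw [IntermediateField.adjoin_le_iff, Set.singleton_subset_iff]
        exact hxS
      exact hle hN.mem
    have hηS : η ∈ IntermediateField.adjoin ℂ {z, y'} := by
      have : η = y' * (D ^ 10 * aeval z H) / aeval x φ.denom ^ 2 := by
        rw [hy']
        field_simp
      rw [this]
      exact div_mem (mul_mem hyS (mul_mem (pow_mem hDS 10) (aeval_mem_intermediateField hzS H)))
        (pow_mem (hS _) 2)
    obtain ⟨r, s, hr, hs, hrs⟩ := exists_completedYCoord_eq hC hψ hφ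
    have hr0 := aeval_ne_zero_of_transcendental hC.transcendental hr
    have hy : y = η * aeval x s / aeval x r := by
      rw [eq_div_iff hr0, hrs, mul_comm]
    rintro a (rfl | rfl)
    · exact hxS
    · rw [hy]
      exact div_mem (mul_mem hηS (hS s)) (hS r)

/-- The reflection `z ↦ 1 - z` of the normal form. -/
theorem IsGenusTwoCurve.reflect {u v d w : ℂ} {x y : K}
    (h : IsGenusTwoCurve (normalSextic u v d w) x y) :
    IsGenusTwoCurve (normalSextic (3 - u) (v - 2 * u + 3) (1 - d) (1 - u + v - w)) (1 - x) y := by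
  have hcomp : (normalSextic (3 - u) (v - 2 * u + 3) (1 - d) (1 - u + v - w)).comp (1 - X) =
      normalSextic u v d w := by
    simp only [normalSextic, mul_comp, sub_comp, X_comp, one_comp, C_comp, pow_comp, add_comp,
      map_sub, map_add, map_mul, map_one, map_ofNat, ofNat_comp]
    ring
  have hcomp' : (normalSextic u v d w).comp (1 - X) =
      normalSextic (3 - u) (v - 2 * u + 3) (1 - d) (1 - u + v - w) := by
    rw [← hcomp, comp_assoc]
    simp
  refine ⟨?_, Or.inr (natDegree_normalSextic _ _ _ _), ?_, ?_, ?_⟩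
  · intro p hp
    obtain ⟨r, hr⟩ := hp
    have h1 := h.squarefree (p.comp (1 - X)) ⟨r.comp (1 - X), by
      rw [← mul_comp, ← mul_comp, ← hr, hcomp]⟩
    have h2 := h1.map (compRingHom (1 - X))
    rw [coe_compRingHom_apply, comp_assoc] at h2
    simpa using h2
  · intro hx
    have := (isAlgebraic_one (R := ℂ) (A := K)).sub hx
    rw [sub_sub_cancel] at this
    exact h.transcendental this
  · rw [h.equation, ← hcomp, aeval_comp]
    simp
  · rw [eq_top_iff, ← h.generates, IntermediateField.adjoin_le_iff]
    rintro a (rfl | rfl)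
    · have := sub_mem (one_mem _) (IntermediateField.subset_adjoin ℂ {1 - a, y}
        (Set.mem_insert (1 - a) {y}))
      rwa [sub_sub_cancel] at this
    · exact IntermediateField.subset_adjoin _ _ (by simp)

end Model

/-- The values of the parameters in the exceptional case `s² = 5`. -/
theorem exceptional_values {s u v d w t : ℂ} (h : s ^ 2 = 5)
    (hd : d = -(s - 1) ^ 2 / (4 * s)) (hu : u = (-s ^ 2 + 12 * s + 5) / (8 * s))
    (hv : v = (-5 * s ^ 4 - 32 * s ^ 3 + 122 * s ^ 2 + 160 * s + 75) / (256 * s ^ 2))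
    (hw : w = (-3 * s ^ 6 - 10 * s ^ 5 - 29 * s ^ 4 - 12 * s ^ 3 + 35 * s ^ 2 + 150 * s + 125)
        / (1024 * s ^ 3))
    (ht : t = (-27 * s ^ 8 - 36 * s ^ 6 + 512 * s ^ 5 - 50 * s ^ 4 - 2500 * s ^ 2 + 3125)
        / (1024 * s ^ 5)) :
    u = 3 / 2 ∧ v = 7 / 16 ∧ d = (5 - 3 * s) / 10 ∧ w = (-s - 1) / 32 ∧ t = (2 - s) / 4 := by
  have hs : s ≠ 0 := by
    rintro rfl
    norm_num at h
  have h3 : s ^ 3 = 5 * s := by linear_combination s * h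
  have h4 : s ^ 4 = 25 := by linear_combination (s ^ 2 + 5) * h
  have h5 : s ^ 5 = 25 * s := by linear_combination s * h4
  have h6 : s ^ 6 = 125 := by linear_combination s ^ 2 * h4 + 25 * h
  have h8 : s ^ 8 = 625 := by linear_combination (s ^ 4 + 25) * h4
  refine ⟨?_, ?_, ?_, ?_, ?_⟩
  · rw [hu, div_eq_iff (by simpa using hs)]
    linear_combination -h
  · rw [hv, div_eq_iff (by simpa using hs)]
    linear_combination -5 * h4 - 32 * h3 + 10 * h
  · rw [hd, div_eq_iff (by simpa using hs)]
    linear_combination h / 5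
  · rw [hw, div_eq_iff (by simpa using hs)]
    linear_combination -3 * h6 - 10 * h5 + 3 * h4 + 20 * h3 + 35 * h
  · rw [ht, div_eq_iff (by simpa using hs)]
    linear_combination -27 * h8 + 220 * h6 - 50 * h4 - 2500 * h

theorem mainTheorem8 {K : Type*} [Field K] [Algebra ℂ K]
    (f : ℂ[X]) (x y : K) (hC : IsGenusTwoCurve f x y)
    (E₁ : WeierstrassCurve ℂ) [E₁.IsElliptic]
    (ψ : E₁.toAffine.FunctionField →ₐ[ℂ] K) (hψ : coverDegree ψ = 5)
    (φ : RatFunc ℂ) (hφ : IsFreyKaniCover x ψ φ)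
    (htype : HasRamificationType φ (typeTwoThree 5)) :
    ∃ u v d w t : ℂ,
      (∃ x' y' : K, IsGenusTwoCurve (normalSextic u v d w) x' y') ∧
      (∃ c : WeierstrassCurve.VariableChange ℂ, c • E₁ = legendreCurve t) ∧
      15 * u ^ 4 - 82 * u ^ 3 - 8 * v * u ^ 2 + 159 * u ^ 2 - 140 * u + 56 * v * u
        - 16 * v ^ 2 - 52 * v + 50 = 0 ∧
      ((2 * u - 3 ≠ 0 ∧ 6 * u ^ 2 - 10 * u + 5 - 8 * v ≠ 0 ∧
        d = (3 * u ^ 2 - 4 * u - 4 * v + 1) ^ 2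
          / ((2 * u - 3) * (6 * u ^ 2 - 10 * u + 5 - 8 * v)) ∧
        w = -((u ^ 2 - 6 * u + 4 * v + 5) * (u ^ 2 - 4 * v) / (8 * (2 * u - 3))) ∧
        t = (u ^ 2 - 4 * v)
            * (-8 * u ^ 4 + 24 * u ^ 3 + 63 * u ^ 2 + 64 * v ^ 2 - 192 * u * v + 196 * v
              + 16 * u ^ 2 * v - 180 * u + 100)
          / ((2 * u - 3) * (6 * u ^ 2 - 10 * u + 5 - 8 * v))) ∨
       (u = 3 / 2 ∧ v = 7 / 16 ∧
        d = (5 + 3 * (Real.sqrt 5 : ℂ)) / 10 ∧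
        w = ((Real.sqrt 5 : ℂ) - 1) / 32 ∧
        t = (2 + (Real.sqrt 5 : ℂ)) / 4)) := by
  obtain ⟨q, hq, hram, hun⟩ := htype
  have hdeg := mapDegree_eq_five hC hψ hφ
  obtain ⟨z, D, α₁, α₂, β₁, β₂, d, g, ρ₁, ρ₂, ρ₃, κ, hN⟩ := exists_normalFibres
    hC.transcendental hdeg hq (hram 0) (hram 1) (hram 2) (hram 3)
  obtain ⟨hinf, hE, hprod⟩ := branchPoints_eq hC hψ hφ hun
  obtain ⟨y', hy'⟩ := hN.exists_isGenusTwoCurve hC hψ hφ hprod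
  obtain ⟨δ, k, hδ, hcross, h₁, h₂⟩ := hN.exists_identities hq
  obtain ⟨c, hc⟩ := exists_variableChange_crossRatio E₁ hq hE hinf
  rw [← hcross] at hc
  obtain ⟨s, hs, hd, hu, hv, hw, ht⟩ := parametrization_of_fibre_identities
    (a := -(α₁ + α₂)) (b := α₁ * α₂) (a' := -(β₁ + β₂)) (b' := β₁ * β₂)
    (u := ρ₁ + ρ₂ + ρ₃) (v := ρ₁ * ρ₂ + ρ₁ * ρ₃ + ρ₂ * ρ₃) (w := ρ₁ * ρ₂ * ρ₃)
    (d := d) (g := g) (δ := δ) (k := k) (fun t => by linear_combination h₁ t)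
    (fun t => by linear_combination h₂ t) hδ
    (by
      have := mul_ne_zero (sub_ne_zero.mpr hN.ne_α.1) (sub_ne_zero.mpr hN.ne_α.2)
      intro h0
      exact this (by linear_combination h0))
    (by
      have := mul_ne_zero (sub_ne_zero.mpr hN.ne_β.1) (sub_ne_zero.mpr hN.ne_β.2)
      intro h0
      exact this (by linear_combination h0))
  obtain ⟨hquartic, hgen | h5⟩ := formulas_of_parametrization hs hd hu hv hw ht
  · exact ⟨_, _, d, _, _, ⟨z, y', hy'⟩, ⟨c, hc⟩, hquartic, Or.inl hgen⟩
  · have hr : (Real.sqrt 5 : ℂ) ^ 2 = 5 := by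
      rw [← Complex.ofReal_pow, Real.sq_sqrt (by norm_num)]
      norm_num
    obtain ⟨eu, ev, ed, ew, et⟩ := exceptional_values h5 hd hu hv hw ht
    rcases sq_eq_sq_iff_eq_or_eq_neg.mp (h5.trans hr.symm) with rfl | rfl
    -- Interchanging the two fibres with ramification `2, 2` changes the sign of `√5`.
    · obtain ⟨c', hc'⟩ := exists_variableChange_legendreCurve_one_sub (k / δ)
      refine ⟨_, _, _, _, _, ⟨_, _, hy'.reflect⟩, ⟨c' * c, by rw [mul_smul, hc, hc']⟩, ?_,
        Or.inr ⟨?_, ?_, ?_, ?_, ?_⟩⟩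
      · rw [eu, ev]; norm_num
      · rw [eu]; norm_num
      · rw [eu, ev]; norm_num
      · rw [ed]; ring
      · rw [eu, ev, ew]; ring
      · rw [et]; ring
    · refine ⟨_, _, d, _, _, ⟨z, y', hy'⟩, ⟨c, hc⟩, hquartic, Or.inr ⟨eu, ev, ?_, ?_, ?_⟩⟩
      · rw [ed]; ring
      · rw [ew]; ring
      · rw [et]; ring
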